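/- Conventions. Let $X$ be a uniform space. For a symmetric entourage $E$ of $X$, the Rips complex $R(X,E)$ is the simplicial complex on the vertex set $X$ whose simplices are the nonempty finite subsets $A$ with $A\times A\subseteq E$. For $E\subseteq X\times X$, an $E$-chain from $x$ to $y$ is a finite sequence $x=x_1,\dots,x_n=y$ with $(x_i,x_{i+1})\in E$ for $i<n$. When $E$ is a symmetric entourage, two $E$-chains with the same endpoints are $E$-homotopic if the edge paths they determine in the geometric realization of $R(X,E)$ are homotopic relative endpoints. A generalized path from $x$ to $y$ is a family $\alpha=([\alpha_E])_E$, indexed by the symmetric entourages $E$ of $X$, of $E$-homotopy classes of $E$-chains from $x$ to $y$ such that $\alpha_F$ is $E$-homotopic to $\alpha_E$ whenever $F\subseteq E$. It is $E$-short if $(x,y)\in E$ and $\alpha_E$ is $E$-homotopic to the chain $x,y$. The generalized loops at $x$ form a group $\check\pi_1(X,x)$ under concatenation, and a uniformly continuous map $f:Z\to X$ induces a homomorphism $f_*:\check\pi_1(Z,z)\to\check\pi_1(X,f(z))$, $(f_*\alpha)_E=f(\alpha_{f^{-1}(E)})$. The space $X$ is chain connected if for every entourage $E$ any two points are joined by an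 $E$-chain. It is locally uniform joinable if for every symmetric entourage $E$ there is an entourage $F\subseteq E$ such that any $(x,y)\in F$ can be joined by an $E$-short generalized path. It is semilocally simply uniform joinable if there is a symmetric entourage $E$ such that every generalized loop whose $E$-term is trivial is trivial. A map $f:Z\to X$ of uniform spaces is a uniform covering map if (i) $f$ is uniformly continuous and $f(E)=(f\times f)(E)$ is an entourage of $X$ for every entourage $E$ of $Z$; (ii) for every entourage $E$ of $Z$ there is an entourage $F$ of $Z$ such that, for every $z\in Z$, every $f(F)$-chain starting at $f(z)$ lifts to an $E$-chain starting at $z$; and (iii) for every entourage $E$ of $Z$ there is an entourage $F\subseteq E$ such that any two $F$-chains in $Z$ starting at the same point with identical images under $f$ are equal. Two uniform covering maps $f:Z\to X$ and $g:Z'\to X$ are uniform equivalent if there is a uniform equivalence (a bijection uniformly continuous in both directions) $h:Z\to Z'$ with $f=g\circ h$. Theorem. Let $X$ be a Hausdorff uniform space that is locally uniform joinable, chain connected and semilocally simply uniform joinable, and let $x_0\in X$. Then there is a bijection from the set of uniform equivalence classes of uniform covering maps $f:Z\to X$ with $Z$ chain connected onto the set of conjugacy classes of subgroups of $\check\pi_1(X,x_0)$,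 such that, for every such $f$ and every $z_0\in f^{-1}(x_0)$, the class of $f$ is sent to the conjugacy class of $f_*(\check\pi_1(Z,z_0))$. -/

import Mathlib

open scoped Uniformity

universe u

namespace UniformCovering

/-! ### Geometric realization of an abstract simplicial complex -/

section Realization

variable {V W : Type u}

/-- The points of the geometric realization `|K|`: barycentric coordinates whose support is a
simplex of `K`. -/
@[ext]
structure Realization (K : AbstractSimplicialComplex V) where
  coord : V →₀ ℝ
  support_mem : coord.support ∈ K.faces
  nonneg : ∀ v, 0 ≤ coord v
  sum_eq_one : (coord.sum fun _ r => r) = 1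

/-- The closed simplex of `|K|` spanned by the finite set `s`. -/
def closedFace (K : AbstractSimplicialComplex V) (s : Finset V) : Set (Realization K) :=
  {p | p.coord.support ⊆ s}

/-- The Euclidean topology of a closed simplex, given by the barycentric coordinates. -/
@[reducible]
def closedFaceTopology (K : AbstractSimplicialComplex V) (s : Finset V) :
    TopologicalSpace (closedFace K s) :=
  TopologicalSpace.induced (fun p (v : V) => p.1.coord v) inferInstance

/-- The weak topology of `|K|`: a set is open if and only if its trace on every closed simplex
is open. -/
instance (K : AbstractSimplicialComplex V) : TopologicalSpace (Realization K) :=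
  ⨆ s : K.faces, TopologicalSpace.coinduced Subtype.val (closedFaceTopology K s.1)

theorem continuous_realization_dom {K : AbstractSimplicialComplex V} {Z : Type*}
    [TopologicalSpace Z] {g : Realization K → Z}
    (hg : ∀ s ∈ K.faces, @Continuous _ _ (closedFaceTopology K s) _
      (fun p : closedFace K s => g p.1)) : Continuous g := by
  rw [continuous_iSup_dom]
  intro s
  rw [continuous_coinduced_dom]
  exact hg s.1 s.2

theorem continuous_realization_rng {K : AbstractSimplicialComplex V} {Z : Type*}
    [TopologicalSpace Z] {g : Z → Realization K} {s : Finset V} (hs : s ∈ K.faces)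
    (hsupp : ∀ z, (g z).coord.support ⊆ s) (hg : ∀ v, Continuous fun z => (g z).coord v) :
    Continuous g := by
  have h1 : @Continuous _ _ _ (closedFaceTopology K s)
      (fun z => (⟨g z, hsupp z⟩ : closedFace K s)) := by
    rw [closedFaceTopology, continuous_induced_rng]
    exact continuous_pi hg
  have h2 : @Continuous _ _ (closedFaceTopology K s) _
      (Subtype.val : closedFace K s → Realization K) := by
    rw [continuous_iff_coinduced_le]
    exact le_iSup (fun s : K.faces =>
      TopologicalSpace.coinduced (Subtype.val : closedFace K s.1 → Realization K)
        (closedFaceTopology K s.1)) ⟨s, hs⟩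
  exact @Continuous.comp _ _ _ _ (closedFaceTopology K s) _ _ _ h2 h1

theorem face_nonempty (K : AbstractSimplicialComplex V) {s : Finset V} (hs : s ∈ K.faces) :
    s.Nonempty := (K.isRelLowerSet_faces hs).1

theorem face_of_subset (K : AbstractSimplicialComplex V) {s t : Finset V} (hs : s ∈ K.faces)
    (hts : t ⊆ s) (ht : t.Nonempty) : t ∈ K.faces := (K.isRelLowerSet_faces hs).2 hts ht

theorem support_nonempty_of_sum {w : V →₀ ℝ} (hw : (w.sum fun _ r => r) = 1) :
    w.support.Nonempty := by
  rw [Finset.nonempty_iff_ne_empty]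
  intro h
  rw [Finsupp.sum, h] at hw
  simp at hw

/-- The vertex `v` as a point of `|K|`. -/
noncomputable def vertexPt (K : AbstractSimplicialComplex V) (v : V) : Realization K where
  coord := Finsupp.single v 1
  support_mem := by
    rw [Finsupp.support_single v one_ne_zero]; exact K.singleton_mem v
  nonneg x := by
    classical
    rw [Finsupp.single_apply]; split_ifs <;> norm_num
  sum_eq_one := by simp

open Classical in
theorem support_edge_subset (x y : V) (a b : ℝ) :
    (Finsupp.single x a + Finsupp.single y b).support ⊆ ({x, y} : Finset V) :=
  Finsupp.support_add.trans (Finset.union_subset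
    (Finsupp.support_single_subset.trans (by simp))
    (Finsupp.support_single_subset.trans (by simp)))

open Classical in
/-- The point `(1 - t) x + t y` of the edge (or, if `x = y`, the vertex) `{x, y}` of `K`. -/
noncomputable def edgePt (K : AbstractSimplicialComplex V) {x y : V}
    (h : ({x, y} : Finset V) ∈ K.faces) (t : unitInterval) : Realization K where
  coord := Finsupp.single x (1 - (t : ℝ)) + Finsupp.single y (t : ℝ)
  support_mem := by
    refine face_of_subset K h (support_edge_subset _ _ _ _) (support_nonempty_of_sum ?_)
    rw [Finsupp.sum_add_index' (fun _ => rfl) (fun _ _ _ => rfl),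
      Finsupp.sum_single_index rfl, Finsupp.sum_single_index rfl, sub_add_cancel]
  nonneg v := by
    have h0 := t.2.1
    have h1 := t.2.2
    rw [Finsupp.add_apply, Finsupp.single_apply, Finsupp.single_apply]
    split_ifs <;> linarith
  sum_eq_one := by
    rw [Finsupp.sum_add_index' (fun _ => rfl) (fun _ _ _ => rfl),
      Finsupp.sum_single_index rfl, Finsupp.sum_single_index rfl, sub_add_cancel]

open Classical in
/-- The straight path from the vertex `x` to the vertex `y`. -/
noncomputable def edgePath (K : AbstractSimplicialComplex V) {x y : V}
    (h : ({x, y} : Finset V) ∈ K.faces) : Path (vertexPt K x) (vertexPt K y) where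
  toFun := edgePt K h
  continuous_toFun := by
    refine continuous_realization_rng h (fun t => support_edge_subset _ _ _ _) (fun v => ?_)
    simp only [edgePt, Finsupp.add_apply, Finsupp.single_apply]
    split_ifs <;> fun_prop
  source' := by
    apply Realization.ext
    simp [vertexPt, edgePt]
  target' := by
    apply Realization.ext
    simp [vertexPt, edgePt]

open Classical in
/-- A map of vertices that sends simplices to simplices. -/
def IsSimplicial (K : AbstractSimplicialComplex V) (L : AbstractSimplicialComplex W)
    (f : V → W) : Prop :=
  ∀ s ∈ K.faces, s.image f ∈ L.faces

/-- The map `|K| → |L|` that is affine on simplices and extends a simplicial map. -/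
noncomputable def realizationMap {K : AbstractSimplicialComplex V}
    {L : AbstractSimplicialComplex W} {f : V → W} (hf : IsSimplicial K L f) :
    C(Realization K, Realization L) where
  toFun p :=
    { coord := Finsupp.mapDomain f p.coord
      support_mem := by
        classical
        refine face_of_subset L (hf _ p.support_mem) ?_ (support_nonempty_of_sum ?_)
        · convert Finsupp.mapDomain_support (f := f) (s := p.coord)
        · rw [Finsupp.sum_mapDomain_index (fun _ => rfl) (fun _ _ _ => rfl)]
          exact p.sum_eq_one
      nonneg := fun w => by
        classical
        rw [Finsupp.mapDomain, Finsupp.sum_apply]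
        refine Finset.sum_nonneg fun v _ => ?_
        simp only [Finsupp.single_apply]
        split_ifs
        · exact p.nonneg v
        · exact le_rfl
      sum_eq_one := by
        rw [Finsupp.sum_mapDomain_index (fun _ => rfl) (fun _ _ _ => rfl)]
        exact p.sum_eq_one }
  continuous_toFun := by
    classical
    refine continuous_realization_dom fun s hs => ?_
    let _ := closedFaceTopology K s
    refine continuous_realization_rng (hf s hs) (fun p => ?_) (fun w => ?_)
    · refine Finsupp.mapDomain_support.trans ?_
      intro w hw
      simp only [Finset.mem_image] at hw ⊢
      obtain ⟨v, hv, rfl⟩ := hw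
      exact ⟨v, p.2 hv, rfl⟩
    · have hcoord : ∀ v, Continuous fun p : closedFace K s => p.1.coord v := fun v =>
        (continuous_apply v).comp continuous_induced_dom
      have : (fun p : closedFace K s => (Finsupp.mapDomain f p.1.coord) w) =
          fun p : closedFace K s => ∑ v ∈ s, if f v = w then p.1.coord v else 0 := by
        funext p
        rw [Finsupp.mapDomain, Finsupp.sum_apply, Finsupp.sum_of_support_subset _ p.2]
        · simp only [Finsupp.single_apply]
        · intro v _; simp
      change Continuous (fun p : closedFace K s => (Finsupp.mapDomain f p.1.coord) w)
      rw [this]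
      refine continuous_finsetSum s fun v _ => ?_
      split_ifs
      · exact hcoord v
      · exact continuous_const

theorem realizationMap_vertexPt {K : AbstractSimplicialComplex V}
    {L : AbstractSimplicialComplex W} {f : V → W} (hf : IsSimplicial K L f) (v : V) :
    realizationMap hf (vertexPt K v) = vertexPt L (f v) :=
  Realization.ext Finsupp.mapDomain_single

theorem realizationMap_edgePt {K : AbstractSimplicialComplex V}
    {L : AbstractSimplicialComplex W} {f : V → W} (hf : IsSimplicial K L f) {x y : V}
    (h : open Classical in ({x, y} : Finset V) ∈ K.faces)
    (h' : open Classical in ({f x, f y} : Finset W) ∈ L.faces) (t : unitInterval) :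
    realizationMap hf (edgePt K h t) = edgePt L h' t := by
  apply Realization.ext
  change Finsupp.mapDomain f (_ + _) = _
  rw [Finsupp.mapDomain_add, Finsupp.mapDomain_single, Finsupp.mapDomain_single]
  rfl

open Classical in
theorem edgePath_symm (K : AbstractSimplicialComplex V) {x y : V}
    (h : ({x, y} : Finset V) ∈ K.faces) (h' : ({y, x} : Finset V) ∈ K.faces) :
    edgePath K h' = (edgePath K h).symm := by
  refine Path.ext (funext fun t => ?_)
  apply Realization.ext
  change Finsupp.single y (1 - (t : ℝ)) + Finsupp.single x (t : ℝ) =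
    Finsupp.single x (1 - (unitInterval.symm t : ℝ)) +
      Finsupp.single y (unitInterval.symm t : ℝ)
  rw [unitInterval.coe_symm_eq, sub_sub_cancel, add_comm]

end Realization

/-! ### Entourages, chains and homotopies of chains -/

/-- A symmetric entourage of `X`. -/
structure Entourage (X : Type u) [UniformSpace X] where
  rel : Set (X × X)
  mem : rel ∈ 𝓤 X
  symm : ∀ {x y}, (x, y) ∈ rel → (y, x) ∈ rel

/-- `EChain E x y`: a finite sequence `x = x₁, …, xₙ = y` with `(xᵢ, xᵢ₊₁) ∈ E` for all `i < n`. -/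
inductive EChain {X : Type u} (E : Set (X × X)) : X → X → Type u
  | nil (x : X) : EChain E x x
  | cons {x y z : X} (h : (x, y) ∈ E) (c : EChain E y z) : EChain E x z

namespace EChain

variable {X Y : Type u} {E : Set (X × X)} {F : Set (Y × Y)}

/-- The sequence of points of a chain. -/
def points {x y : X} : EChain E x y → List X
  | nil x => [x]
  | @cons _ _ x _ _ _ c => x :: c.points

/-- Concatenation of chains. -/
def append {x y z : X} : EChain E x y → EChain E y z → EChain E x z
  | nil _, d => d
  | cons h c, d => cons h (c.append d)

/-- The inverse (reversed) chain, for a symmetric relation. -/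
def reverse (hE : ∀ {x y}, (x, y) ∈ E → (y, x) ∈ E) {x y : X} : EChain E x y → EChain E y x
  | nil x => nil x
  | cons h c => (c.reverse hE).append (cons (hE h) (nil _))

/-- The image of a chain. -/
def map (f : X → Y) (hf : ∀ {x y}, (x, y) ∈ E → (f x, f y) ∈ F) {x y : X} :
    EChain E x y → EChain F (f x) (f y)
  | nil x => nil (f x)
  | cons h c => cons (hf h) (c.map f hf)

theorem map_append (f : X → Y) (hf : ∀ {x y}, (x, y) ∈ E → (f x, f y) ∈ F) {x y z : X}
    (c : EChain E x y) (d : EChain E y z) :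
    (c.append d).map f hf = (c.map f hf).append (d.map f hf) := by
  induction c with
  | nil x => rfl
  | cons h c ih => simp only [append, map, ih]

theorem map_reverse (f : X → Y) (hf : ∀ {x y}, (x, y) ∈ E → (f x, f y) ∈ F)
    (hE : ∀ {x y}, (x, y) ∈ E → (y, x) ∈ E) (hF : ∀ {x y}, (x, y) ∈ F → (y, x) ∈ F) {x y : X}
    (c : EChain E x y) : (c.reverse hE).map f hf = (c.map f hf).reverse hF := by
  induction c with
  | nil x => rfl
  | cons h c ih => simp only [reverse, map, map_append, ih]

theorem map_map {Z : Type u} {G : Set (Z × Z)} (f : X → Y) (g : Y → Z)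
    (hf : ∀ {x y}, (x, y) ∈ E → (f x, f y) ∈ F) (hg : ∀ {x y}, (x, y) ∈ F → (g x, g y) ∈ G)
    {x y : X} (c : EChain E x y) :
    (c.map f hf).map g hg = c.map (fun x => g (f x)) (fun h => hg (hf h)) := by
  induction c with
  | nil x => rfl
  | cons h c ih => simp only [map, ih]

end EChain

variable {X Y : Type u} [UniformSpace X] [UniformSpace Y]

/-- The Rips complex `R(X, E)`: the simplices are the nonempty finite `E`-bounded subsets. -/
def rips (E : Entourage X) : AbstractSimplicialComplex X where
  faces := {s | s.Nonempty ∧ ∀ x ∈ s, ∀ y ∈ s, (x, y) ∈ E.rel}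
  isRelLowerSet_faces := fun _ hs =>
    ⟨hs.1, fun _ hts ht => ⟨ht, fun x hx y hy => hs.2 x (hts hx) y (hts hy)⟩⟩
  singleton_mem v := ⟨Finset.singleton_nonempty v, fun x hx y hy => by
    rw [Finset.mem_singleton.1 hx, Finset.mem_singleton.1 hy]
    exact refl_mem_uniformity E.mem⟩

open Classical in
theorem edge_mem_rips {E : Entourage X} {x y : X} (h : (x, y) ∈ E.rel) :
    ({x, y} : Finset X) ∈ (rips E).faces := by
  refine ⟨⟨x, by simp⟩, fun a ha b hb => ?_⟩
  have hr : ∀ a : X, (a, a) ∈ E.rel := fun a => refl_mem_uniformity E.mem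
  simp only [Finset.mem_insert, Finset.mem_singleton] at ha hb
  rcases ha with rfl | rfl <;> rcases hb with rfl | rfl
  · exact hr _
  · exact h
  · exact E.symm h
  · exact hr _

theorem isSimplicial_rips {E : Entourage X} {F : Entourage Y} {f : X → Y}
    (hf : ∀ {x y}, (x, y) ∈ E.rel → (f x, f y) ∈ F.rel) :
    IsSimplicial (rips E) (rips F) f := by
  classical
  intro s hs
  refine ⟨by convert hs.1.image f, fun a ha b hb => ?_⟩
  simp only [Finset.mem_image] at ha hb
  obtain ⟨x, hx, rfl⟩ := ha
  obtain ⟨y, hy, rfl⟩ := hb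
  exact hf (hs.2 x hx y hy)

/-- The path in `|R(X, E)|` determined by an `E`-chain: consecutive terms are joined by edge
paths. -/
noncomputable def EChain.toPath {E : Entourage X} {x y : X} :
    EChain E.rel x y → Path (vertexPt (rips E) x) (vertexPt (rips E) y)
  | .nil x => Path.refl (vertexPt (rips E) x)
  | .cons h c => (edgePath (rips E) (edge_mem_rips h)).trans c.toPath

/-- `E`-homotopy relative endpoints: the associated paths in the Rips complex are homotopic
relative endpoints. -/
def chainSetoid (E : Entourage X) (x y : X) : Setoid (EChain E.rel x y) where
  r c d := c.toPath.Homotopic d.toPath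
  iseqv := ⟨fun _ => Path.Homotopic.refl _, fun h => h.symm, fun h k => h.trans k⟩

/-- `E`-homotopy classes relative endpoints of `E`-chains from `x` to `y`. -/
def ChainClass (E : Entourage X) (x y : X) : Type u := Quotient (chainSetoid E x y)

theorem toPath_append {E : Entourage X} {x y z : X} (c : EChain E.rel x y)
    (d : EChain E.rel y z) : (c.append d).toPath.Homotopic (c.toPath.trans d.toPath) := by
  induction c with
  | nil x => exact (Path.Homotopic.refl_trans _).symm
  | cons h c ih =>
    exact ((Path.Homotopic.refl _).hcomp (ih d)).trans (Path.Homotopic.trans_assoc _ _ _).symm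

theorem toPath_reverse {E : Entourage X} {x y : X} (c : EChain E.rel x y) :
    (c.reverse E.symm).toPath.Homotopic c.toPath.symm := by
  classical
  induction c with
  | nil x => exact Path.Homotopic.refl _
  | cons h c ih =>
    refine (toPath_append _ _).trans ?_
    simp only [EChain.toPath]
    rw [Path.trans_symm]
    refine Path.Homotopic.hcomp ih ?_
    refine (Path.Homotopic.trans_refl _).trans ?_
    rw [← edgePath_symm (rips E) (edge_mem_rips h) (edge_mem_rips (E.symm h))]

theorem edgePath_map {E : Entourage X} {F : Entourage Y} {f : X → Y}
    (hf : ∀ {x y}, (x, y) ∈ E.rel → (f x, f y) ∈ F.rel) {x y : X} (h : (x, y) ∈ E.rel) :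
    edgePath (rips F) (edge_mem_rips (hf h)) =
      ((edgePath (rips E) (edge_mem_rips h)).map
        (realizationMap (isSimplicial_rips hf)).continuous).cast
        (realizationMap_vertexPt _ _).symm (realizationMap_vertexPt _ _).symm := by
  refine Path.ext (funext fun t => ?_)
  exact (realizationMap_edgePt (isSimplicial_rips hf) (edge_mem_rips h)
    (edge_mem_rips (hf h)) t).symm

theorem toPath_map {E : Entourage X} {F : Entourage Y} {f : X → Y}
    (hf : ∀ {x y}, (x, y) ∈ E.rel → (f x, f y) ∈ F.rel) {x y : X} (c : EChain E.rel x y) :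
    (c.map f hf).toPath =
      (c.toPath.map (realizationMap (isSimplicial_rips hf)).continuous).cast
        (realizationMap_vertexPt _ _).symm (realizationMap_vertexPt _ _).symm := by
  induction c with
  | nil x =>
    refine Path.ext (funext fun t => ?_)
    exact (realizationMap_vertexPt (isSimplicial_rips hf) _).symm
  | cons h c ih =>
    simp only [EChain.map, EChain.toPath]
    rw [ih, edgePath_map hf h, Path.map_trans]
    rfl

namespace ChainClass

variable {E : Entourage X} {F : Entourage Y}

/-- The class of a chain. -/
def mk {x y : X} (c : EChain E.rel x y) : ChainClass E x y := Quotient.mk (chainSetoid E x y) c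

theorem mk_eq {x y : X} {c d : EChain E.rel x y} :
    mk c = mk d ↔ c.toPath.Homotopic d.toPath := Quotient.eq

/-- The class of the constant chain. -/
def refl (E : Entourage X) (x : X) : ChainClass E x x := mk (.nil x)

/-- Concatenation of classes of chains. -/
def trans {x y z : X} : ChainClass E x y → ChainClass E y z → ChainClass E x z :=
  Quotient.map₂ EChain.append fun _ _ h _ _ k =>
    (toPath_append _ _).trans ((h.hcomp k).trans (toPath_append _ _).symm)

/-- Inverse of a class of chains. -/
def symm {x y : X} : ChainClass E x y → ChainClass E y x :=
  Quotient.map (EChain.reverse E.symm) fun _ _ h =>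
    (toPath_reverse _).trans (h.symm₂.trans (toPath_reverse _).symm)

/-- Image of a class of chains. -/
def map (f : X → Y) (hf : ∀ {x y}, (x, y) ∈ E.rel → (f x, f y) ∈ F.rel) {x y : X} :
    ChainClass E x y → ChainClass F (f x) (f y) :=
  Quotient.map (EChain.map f hf) fun c d h => by
    change (c.map f hf).toPath.Homotopic (d.map f hf).toPath
    rw [toPath_map, toPath_map]
    exact (Path.Homotopic.map h (realizationMap (isSimplicial_rips hf))).pathCast _ _

/-- For `E ⊆ E'`, the `E'`-homotopy class of a class of `E`-chains. -/
def coarsen {E' : Entourage X} (h : E.rel ⊆ E'.rel) {x y : X} (a : ChainClass E x y) :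
    ChainClass E' x y :=
  a.map id fun hxy => h hxy

theorem trans_assoc {x y z w : X} (a : ChainClass E x y) (b : ChainClass E y z)
    (c : ChainClass E z w) : (a.trans b).trans c = a.trans (b.trans c) := by
  induction a using Quotient.inductionOn with | _ a
  induction b using Quotient.inductionOn with | _ b
  induction c using Quotient.inductionOn with | _ c
  refine mk_eq.2 ?_
  refine (toPath_append _ _).trans (((toPath_append _ _).hcomp (.refl _)).trans ?_)
  refine (Path.Homotopic.trans_assoc _ _ _).trans ?_
  exact ((toPath_append _ _).trans ((Path.Homotopic.refl _).hcomp (toPath_append _ _))).symm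

theorem refl_trans {x y : X} (a : ChainClass E x y) : (refl E x).trans a = a := by
  induction a using Quotient.inductionOn with | _ a
  rfl

theorem symm_trans {x y : X} (a : ChainClass E x y) : a.symm.trans a = refl E y := by
  induction a using Quotient.inductionOn with | _ a
  refine mk_eq.2 ?_
  refine (toPath_append _ _).trans (((toPath_reverse _).hcomp (.refl _)).trans ?_)
  exact Path.Homotopic.symm_trans _

theorem trans_refl {x y : X} (a : ChainClass E x y) : a.trans (refl E y) = a := by
  induction a using Quotient.inductionOn with | _ a
  exact mk_eq.2 ((toPath_append _ _).trans (Path.Homotopic.trans_refl _))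

theorem map_trans (f : X → Y) (hf : ∀ {x y}, (x, y) ∈ E.rel → (f x, f y) ∈ F.rel) {x y z : X}
    (a : ChainClass E x y) (b : ChainClass E y z) :
    (a.trans b).map f hf = (a.map f hf : ChainClass F _ _).trans (b.map f hf) := by
  induction a using Quotient.inductionOn with | _ a
  induction b using Quotient.inductionOn with | _ b
  exact congrArg mk (EChain.map_append f hf a b)

theorem map_symm (f : X → Y) (hf : ∀ {x y}, (x, y) ∈ E.rel → (f x, f y) ∈ F.rel) {x y : X}
    (a : ChainClass E x y) : a.symm.map f hf = (a.map f hf : ChainClass F _ _).symm := by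
  induction a using Quotient.inductionOn with | _ a
  exact congrArg mk (EChain.map_reverse f hf E.symm F.symm a)

theorem coarsen_map {E' : Entourage X} {F' : Entourage Y} (f : X → Y)
    (hf : ∀ {x y}, (x, y) ∈ E.rel → (f x, f y) ∈ F.rel)
    (hf' : ∀ {x y}, (x, y) ∈ E'.rel → (f x, f y) ∈ F'.rel)
    (hE : E.rel ⊆ E'.rel) (hF : F.rel ⊆ F'.rel) {x y : X} (a : ChainClass E x y) :
    (a.map f hf : ChainClass F _ _).coarsen hF = (a.coarsen hE).map f hf' := by
  induction a using Quotient.inductionOn with | _ a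
  refine congrArg mk ?_
  exact (EChain.map_map f id hf (fun h => hF h) a).trans
    (EChain.map_map id f (fun h => hE h) hf' a).symm

end ChainClass

/-! ### Generalized paths and the uniform fundamental group -/

/-- A generalized path from `x` to `y`: for every entourage `E` a homotopy class of `E`-chains,
such that for `F ⊆ E` the `F`-term is `E`-homotopic relative endpoints to the `E`-term. -/
@[ext]
structure GenPath (x y : X) where
  term : ∀ E : Entourage X, ChainClass E x y
  compat : ∀ (F E : Entourage X) (h : F.rel ⊆ E.rel), (term F).coarsen h = term E

namespace GenPath

/-- The constant (trivial) generalized path. -/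
def refl (x : X) : GenPath x x where
  term E := ChainClass.refl E x
  compat _ _ _ := rfl

/-- Concatenation of generalized paths. -/
def trans {x y z : X} (a : GenPath x y) (b : GenPath y z) : GenPath x z where
  term E := (a.term E).trans (b.term E)
  compat F E h := by
    rw [← a.compat F E h, ← b.compat F E h]
    exact ChainClass.map_trans id (fun hp => h hp) _ _

/-- Inverse of a generalized path. -/
def symm {x y : X} (a : GenPath x y) : GenPath y x where
  term E := (a.term E).symm
  compat F E h := by
    rw [← a.compat F E h]
    exact ChainClass.map_symm id (fun hp => h hp) _

/-- A generalized path from `x` to `y` is `E`-short if its `E`-term is the class of the chain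
`x, y`. -/
def IsShort (E : Entourage X) {x y : X} (a : GenPath x y) : Prop :=
  ∃ h : (x, y) ∈ E.rel, a.term E = ChainClass.mk (.cons h (.nil y))

end GenPath

/-- The preimage of an entourage under a uniformly continuous map. -/
def Entourage.comap (f : X → Y) (hf : UniformContinuous f) (E : Entourage Y) : Entourage X where
  rel := Prod.map f f ⁻¹' E.rel
  mem := hf E.mem
  symm h := E.symm h

/-- The generalized path `f_*(a)`, whose `E`-term is the image of the `f⁻¹(E)`-term of `a`. -/
def GenPath.map (f : X → Y) (hf : UniformContinuous f) {x y : X} (a : GenPath x y) :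
    GenPath (f x) (f y) where
  term E := (a.term (E.comap f hf)).map f fun h => h
  compat F E h := by
    have hc : (F.comap f hf).rel ⊆ (E.comap f hf).rel := fun _ hp => h hp
    rw [← a.compat (F.comap f hf) (E.comap f hf) hc]
    exact ChainClass.coarsen_map f (fun h => h) (fun h => h) hc h _

/-- The uniform fundamental group `π̌₁(X, x)`: generalized loops at `x` under concatenation. -/
def UnifPi1 (X : Type u) [UniformSpace X] (x : X) : Type u := GenPath x x

instance (x : X) : Group (UnifPi1 X x) where
  mul a b := GenPath.trans a b
  one := GenPath.refl x
  inv a := GenPath.symm a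
  mul_assoc a b c := GenPath.ext (funext fun E =>
    ChainClass.trans_assoc (a.term E) (b.term E) (c.term E))
  one_mul a := GenPath.ext (funext fun E => ChainClass.refl_trans (a.term E))
  mul_one a := GenPath.ext (funext fun E => ChainClass.trans_refl (a.term E))
  inv_mul_cancel a := GenPath.ext (funext fun E => ChainClass.symm_trans (a.term E))

/-- The homomorphism `f_* : π̌₁(X, x) → π̌₁(Y, f x)`. -/
def UnifPi1.map (f : X → Y) (hf : UniformContinuous f) (x : X) :
    UnifPi1 X x →* UnifPi1 Y (f x) where
  toFun a := GenPath.map f hf a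
  map_one' := rfl
  map_mul' a b := GenPath.ext (funext fun E =>
    ChainClass.map_trans f (fun h => h) (a.term (E.comap f hf)) (b.term (E.comap f hf)))

/-- The subgroup `f_*(π̌₁(X, x))` of `π̌₁(Y, y)`, where `y = f x`. -/
def UnifPi1.image (f : X → Y) (hf : UniformContinuous f) {x : X} {y : Y} (h : f x = y) :
    Subgroup (UnifPi1 Y y) :=
  h ▸ (UnifPi1.map f hf x).range

/-! ### Properties of uniform spaces -/

/-- Any two points can be joined by an `E`-chain, for every entourage `E`. -/
def ChainConnected (X : Type u) [UniformSpace X] : Prop :=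
  ∀ E ∈ 𝓤 X, ∀ x y : X, Nonempty (EChain E x y)

/-- For every entourage `E` there is an entourage `F ⊆ E` such that any `(x, y) ∈ F` can be
joined by an `E`-short generalized path. -/
def LocallyUniformJoinable (X : Type u) [UniformSpace X] : Prop :=
  ∀ E : Entourage X, ∃ F : Entourage X, F.rel ⊆ E.rel ∧
    ∀ x y : X, (x, y) ∈ F.rel → ∃ a : GenPath x y, a.IsShort E

/-- There is an entourage `E` such that every generalized loop with trivial `E`-term is
trivial. -/
def SemilocallySimplyUniformJoinable (X : Type u) [UniformSpace X] : Prop :=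
  ∃ E : Entourage X, ∀ (x : X) (a : GenPath x x),
    a.term E = ChainClass.refl E x → a = GenPath.refl x

/-! ### Uniform covering maps -/

/-- `f` generates the uniform structure of `Y`. -/
def GeneratesUniformity (f : X → Y) : Prop :=
  UniformContinuous f ∧ ∀ E ∈ 𝓤 X, Prod.map f f '' E ∈ 𝓤 Y

/-- For every entourage `E` there is an entourage `F` such that every `f(F)`-chain starting at
`f x` lifts to an `E`-chain starting at `x`. -/
def HasChainLifting (f : X → Y) : Prop :=
  ∀ E ∈ 𝓤 X, ∃ F ∈ 𝓤 X, ∀ (x : X) (y : Y) (c : EChain (Prod.map f f '' F) (f x) y),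
    ∃ (x' : X) (d : EChain E x x'), d.points.map f = c.points

/-- For every entourage `E` there is an entourage `F ⊆ E` such that any two `F`-chains with the
same starting point and the same image are equal. -/
def HasUniqueChainLifts (f : X → Y) : Prop :=
  ∀ E ∈ 𝓤 X, ∃ F ∈ 𝓤 X, F ⊆ E ∧ ∀ (x y z : X) (c : EChain F x y) (d : EChain F x z),
    c.points.map f = d.points.map f → c.points = d.points

/-- A uniform covering map: it generates the uniform structure of the base and has unique chain
lifting. -/
structure IsUniformCoveringMap (f : X → Y) : Prop where
  generates : GeneratesUniformity f
  chainLifting : HasChainLifting f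
  uniqueChainLifts : HasUniqueChainLifts f

/-- A uniform covering map over `X` with chain connected covering space. -/
structure ChainConnectedCovering (X : Type u) [UniformSpace X] where
  space : Type u
  [uniformSpace : UniformSpace space]
  proj : space → X
  isCovering : IsUniformCoveringMap proj
  chainConnected : ChainConnected space

attribute [instance] ChainConnectedCovering.uniformSpace

/-- Uniform equivalence of uniform covering maps over `X`: a uniform equivalence `h` of the
covering spaces with `f = g ∘ h`. -/
instance coveringSetoid (X : Type u) [UniformSpace X] : Setoid (ChainConnectedCovering X) where
  r f g := ∃ h : f.space ≃ᵤ g.space, f.proj = g.proj ∘ h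
  iseqv := ⟨fun f => ⟨UniformEquiv.refl _, rfl⟩,
    fun {f g} ⟨h, hh⟩ => ⟨h.symm, by rw [hh]; funext z; simp⟩,
    fun {f g k} ⟨h, hh⟩ ⟨h', hh'⟩ => ⟨h.trans h', by rw [hh, hh']; rfl⟩⟩

/-- Conjugacy of subgroups. -/
def subgroupConjSetoid (G : Type u) [Group G] : Setoid (Subgroup G) where
  r H K := ∃ g : G, H.map (MulAut.conj g).toMonoidHom = K
  iseqv := by
    refine ⟨fun H => ⟨1, ?_⟩, fun {H K} => ?_, fun {H K L} => ?_⟩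
    · ext a
      simp
    · rintro ⟨g, rfl⟩
      refine ⟨g⁻¹, ?_⟩
      rw [Subgroup.map_map]
      ext a
      simp [mul_assoc]
    · rintro ⟨g, rfl⟩ ⟨k, rfl⟩
      refine ⟨k * g, ?_⟩
      rw [Subgroup.map_map]
      ext a
      simp [mul_assoc]

/-- Conjugacy classes of subgroups of `G`. -/
def SubgroupConjClasses (G : Type u) [Group G] : Type u := Quotient (subgroupConjSetoid G)

/-- The conjugacy class of a subgroup. -/
def SubgroupConjClasses.mk {G : Type u} [Group G] (H : Subgroup G) : SubgroupConjClasses G :=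
  Quotient.mk (subgroupConjSetoid G) H

/-- Uniform equivalence classes of uniform covering maps over `X` with chain connected covering
space. -/
def CoveringClasses (X : Type u) [UniformSpace X] : Type (u + 1) := Quotient (coveringSetoid X)

/-- The uniform equivalence class of a uniform covering map. -/
def CoveringClasses.mk {X : Type u} [UniformSpace X] (f : ChainConnectedCovering X) :
    CoveringClasses X :=
  Quotient.mk (coveringSetoid X) f

end UniformCovering

open UniformCovering

namespace UniformCovering

/-! ### Coverings of the realization of a simplicial complex -/

section Realization

variable {V : Type u} {K : AbstractSimplicialComplex V}

/-! As in the classical theory, a covering is recovered from the loops that lift to loops, and a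
subgroup `H` is realized by the space of generalized paths from `x₀` modulo `H`. The work lies in
lifting generalized paths, whose terms are homotopy classes in Rips complexes.

Invariance under homotopy is obtained by monodromy: transport of chains in a system of sets, with
transition maps compatible on triangles, is the monodromy of a covering of the realization glued
over the open stars of vertices (`EChain.transport_eq_of_homotopic`). For a uniform covering map,
the fibre over `x` is taken to be the points above `x` together with a homotopy class of chains
upstairs from `z`. Transport then lifts a chain and records the homotopy class of its lift.
Comparing these lifts at all small entourages yields `IsUniformCoveringMap.exists_lifts` and
`Lifts.unique`.

Joinability and semilocal simplicity make every generalized path a product of `E`-short ones, for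
each `E` (`GenPath.short_induction`). Hence in `CoverSpace H` the lift of a path from the base class
ends at its own class (`CoverSpace.lifts_mk`), and the loops that lift to loops are exactly `H`
(`CoverSpace.image_proj`). Conversely, sending a path to the endpoint of its lift identifies the
space built from the loop subgroup of a covering with that covering
(`IsUniformCoveringMap.exists_uniformEquiv`). Moving the base point within its fibre conjugates the
subgroup (`Lifts.conj_iff`). -/

theorem continuous_coord (v : V) : Continuous fun p : Realization K => p.coord v :=
  continuous_realization_dom fun s _ =>
    @Continuous.comp _ _ _ (closedFaceTopology K s) _ _ _ _ (continuous_apply v)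
      continuous_induced_dom

/-- Paths in a closed simplex with the same endpoints are homotopic, by the affine homotopy. -/
theorem homotopic_of_support_subset {a b : Realization K} (p q : Path a b) {s : Finset V}
    (hs : s ∈ K.faces) (hp : ∀ t, (p t).coord.support ⊆ s) (hq : ∀ t, (q t).coord.support ⊆ s) :
    p.Homotopic q := by
  classical
  let H : unitInterval × unitInterval → Realization K := fun z =>
    have hsum : (((1 - (z.1 : ℝ)) • (p z.2).coord + (z.1 : ℝ) • (q z.2).coord).sum
        fun _ r => r) = 1 := by
      rw [Finsupp.sum_add_index' (fun _ => rfl) (fun _ _ _ => rfl),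
        Finsupp.sum_smul_index (fun _ => rfl), Finsupp.sum_smul_index (fun _ => rfl),
        ← Finsupp.mul_sum, ← Finsupp.mul_sum, (p z.2).sum_eq_one, (q z.2).sum_eq_one]
      ring
    { coord := (1 - (z.1 : ℝ)) • (p z.2).coord + (z.1 : ℝ) • (q z.2).coord
      support_mem := face_of_subset K hs
        (Finsupp.support_add.trans (Finset.union_subset (Finsupp.support_smul.trans (hp _))
          (Finsupp.support_smul.trans (hq _)))) (support_nonempty_of_sum hsum)
      nonneg := fun v => by
        have h0 := z.1.2.1
        have h1 : 0 ≤ 1 - (z.1 : ℝ) := sub_nonneg.2 z.1.2.2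
        exact add_nonneg (mul_nonneg h1 ((p z.2).nonneg v)) (mul_nonneg h0 ((q z.2).nonneg v))
      sum_eq_one := hsum }
  have hH : Continuous H := by
    refine continuous_realization_rng hs (fun z => ?_) fun v => ?_
    · exact Finsupp.support_add.trans (Finset.union_subset (Finsupp.support_smul.trans (hp _))
          (Finsupp.support_smul.trans (hq _)))
    · have h1 : Continuous fun z : unitInterval × unitInterval => (p z.2).coord v :=
        (continuous_coord v).comp (p.continuous.comp continuous_snd)
      have h2 : Continuous fun z : unitInterval × unitInterval => (q z.2).coord v :=
        (continuous_coord v).comp (q.continuous.comp continuous_snd)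
      change Continuous fun z : unitInterval × unitInterval =>
        (1 - (z.1 : ℝ)) * (p z.2).coord v + (z.1 : ℝ) * (q z.2).coord v
      fun_prop
  have key : ∀ c : V →₀ ℝ, ∀ t : ℝ, (1 - t) • c + t • c = c := fun c t => by
    rw [← add_smul, sub_add_cancel, one_smul]
  exact ⟨{
    toFun := H
    continuous_toFun := hH
    map_zero_left := fun t => Realization.ext (by simp [H])
    map_one_left := fun t => Realization.ext (by simp [H])
    prop' := fun t x hx => by
      apply Realization.ext
      rcases hx with rfl | hx
      · simp [H, key]
      · rw [Set.mem_singleton_iff.1 hx]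
        simp [H, key] }⟩

/-- The open star of a vertex. -/
def openStar (K : AbstractSimplicialComplex V) (v : V) : Set (Realization K) :=
  {p | 0 < p.coord v}

theorem mem_openStar_iff {p : Realization K} {v : V} :
    p ∈ openStar K v ↔ v ∈ p.coord.support := by
  rw [Finsupp.mem_support_iff]
  exact ⟨fun h => h.ne', fun h => lt_of_le_of_ne (p.nonneg v) h.symm⟩

open Classical in
/-- The bundle over `|K|` with discrete fibre `F` and transition functions `g` over the open
stars of the vertices. -/
noncomputable def starBundle {F : Type*} [TopologicalSpace F] [DiscreteTopology F]
    (g : V → V → F → F) (hself : ∀ v f, g v v f = f)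
    (hcomp : ∀ s ∈ K.faces, ∀ u ∈ s, ∀ v ∈ s, ∀ w ∈ s, ∀ f, g v w (g u v f) = g u w f) :
    FiberBundleCore V (Realization K) F where
  baseSet := openStar K
  isOpen_baseSet v := isOpen_lt continuous_const (continuous_coord v)
  indexAt p := (support_nonempty_of_sum p.sum_eq_one).choose
  mem_baseSet_at p := mem_openStar_iff.2 (support_nonempty_of_sum p.sum_eq_one).choose_spec
  coordChange v w _ := g v w
  coordChange_self v _ _ f := hself v f
  continuousOn_coordChange v w :=
    ((continuous_of_discreteTopology (f := g v w)).comp continuous_snd).continuousOn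
  -- A point lies in the stars of `u`, `v`, `w` only if all three belong to its support, which is a
  -- simplex, so the cocycle condition is needed on simplices only.
  coordChange_comp u v w p hp f := hcomp _ p.support_mem u (mem_openStar_iff.1 hp.1.1)
    v (mem_openStar_iff.1 hp.1.2) w (mem_openStar_iff.1 hp.2) f

section StarBundle

variable {F : Type*} [TopologicalSpace F] [DiscreteTopology F]
  {g : V → V → F → F} (hself : ∀ v f, g v v f = f)
  (hcomp : ∀ s ∈ K.faces, ∀ u ∈ s, ∀ v ∈ s, ∀ w ∈ s, ∀ f, g v w (g u v f) = g u w f)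

/-- The fibre is discrete. This makes monodromy along homotopy classes of paths available. -/
theorem starBundle_isCoveringMap : IsCoveringMap (starBundle g hself hcomp).proj :=
  FiberBundle.isCoveringMap (F := F) (E := (starBundle g hself hcomp).Fiber)

/-- The section of the star bundle over the open star of `v` that is constant in the chart of
`v`. -/
noncomputable def starSection (v : V) (f : F) (p : Realization K) :
    (starBundle g hself hcomp).TotalSpace :=
  ⟨p, g v ((starBundle g hself hcomp).indexAt p) f⟩

theorem continuousOn_starSection (v : V) (f : F) :
    ContinuousOn (starSection hself hcomp v f) (openStar K v) := by
  have h := ((starBundle g hself hcomp).localTriv v).continuousOn_invFun.comp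
    (f := fun p => (p, f)) (s := openStar K v) (by fun_prop) (fun p hp => by
      rw [((starBundle g hself hcomp).localTriv v).target_eq]
      exact ⟨hp, trivial⟩)
  refine h.congr fun p _ => ?_
  exact ((starBundle g hself hcomp).localTriv_symm_apply v (p, f)).symm

theorem starSection_eq {v w : V} (f : F) {p : Realization K} (hv : p ∈ openStar K v)
    (hw : p ∈ openStar K w) :
    starSection hself hcomp w (g v w f) p = starSection hself hcomp v f p := by
  refine congrArg (Bundle.TotalSpace.mk p) ?_
  exact hcomp _ p.support_mem v (mem_openStar_iff.1 hv) w (mem_openStar_iff.1 hw) _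
    (mem_openStar_iff.1 ((starBundle g hself hcomp).mem_baseSet_at p)) f

theorem edgePt_mem_openStar_left {x y : V} (h : open Classical in ({x, y} : Finset V) ∈ K.faces)
    {t : unitInterval} (ht : (t : ℝ) < 1) : edgePt K h t ∈ openStar K x := by
  classical
  change 0 < (Finsupp.single x (1 - (t : ℝ)) + Finsupp.single y (t : ℝ)) x
  have := t.2.1
  rw [Finsupp.add_apply, Finsupp.single_apply, Finsupp.single_apply]
  split_ifs <;> first | linarith | contradiction

theorem edgePt_mem_openStar_right {x y : V} (h : open Classical in ({x, y} : Finset V) ∈ K.faces)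
    {t : unitInterval} (ht : 0 < (t : ℝ)) : edgePt K h t ∈ openStar K y := by
  classical
  change 0 < (Finsupp.single x (1 - (t : ℝ)) + Finsupp.single y (t : ℝ)) y
  have := t.2.2
  rw [Finsupp.add_apply, Finsupp.single_apply, Finsupp.single_apply]
  split_ifs <;> first | linarith | contradiction

/-- The edge lies in the star of `x` up to its last point and in the star of `y` after its first.
The sections attached to `x` and `y` agree on the overlap, so together they give a continuous lift
of the edge path. -/
theorem monodromy_edgePath {x y : V} (h : open Classical in ({x, y} : Finset V) ∈ K.faces)
    (f : F) :
    (starBundle_isCoveringMap hself hcomp).monodromy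
      (Path.Homotopic.Quotient.mk (edgePath K h)) ⟨starSection hself hcomp x f (vertexPt K x), rfl⟩ =
      ⟨starSection hself hcomp y (g x y f) (vertexPt K y), rfl⟩ := by
  -- The vertex `y` need not lie in the star of `x`, but the formula for the section still has the
  -- right value there, because the chart chosen at `y` can only be that of `y`.
  have hend : starSection hself hcomp x f (vertexPt K y) =
      starSection hself hcomp y (g x y f) (vertexPt K y) := by
    have hi := mem_openStar_iff.1 ((starBundle g hself hcomp).mem_baseSet_at (vertexPt K y))
    have hi' : (starBundle g hself hcomp).indexAt (vertexPt K y) = y :=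
      Finset.mem_singleton.1 (Finsupp.support_single_subset hi)
    refine congrArg (Bundle.TotalSpace.mk (vertexPt K y)) ?_
    rw [hi', hself]
  have hc : Continuous fun t => starSection hself hcomp x f (edgePath K h t) := by
    rw [continuous_iff_continuousAt]
    intro t
    by_cases ht : (t : ℝ) < 1
    · exact ((continuousOn_starSection hself hcomp x f).continuousAt
        ((isOpen_lt continuous_const (continuous_coord x)).mem_nhds
          (edgePt_mem_openStar_left h ht))).comp (edgePath K h).continuous.continuousAt
    · have ht0 : 0 < (t : ℝ) := by linarith
      have h1 : ContinuousAt (fun t => starSection hself hcomp y (g x y f) (edgePath K h t)) t :=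
        ((continuousOn_starSection hself hcomp y _).continuousAt
          ((isOpen_lt continuous_const (continuous_coord y)).mem_nhds
            (edgePt_mem_openStar_right h ht0))).comp (edgePath K h).continuous.continuousAt
      refine h1.congr ?_
      filter_upwards [(isOpen_lt continuous_const continuous_subtype_val).mem_nhds ht0] with r hr
      by_cases hr1 : (r : ℝ) < 1
      · exact starSection_eq hself hcomp f (edgePt_mem_openStar_left h hr1)
          (edgePt_mem_openStar_right h hr)
      · have : r = 1 := le_antisymm r.2.2 (not_lt.1 hr1)
        rw [this, (edgePath K h).target]
        exact hend.symm
  let Γ : Path (starSection hself hcomp x f (vertexPt K x))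
      (starSection hself hcomp y (g x y f) (vertexPt K y)) :=
    { toFun := fun t => starSection hself hcomp x f (edgePath K h t)
      continuous_toFun := hc
      source' := by rw [(edgePath K h).source]
      target' := by rw [(edgePath K h).target, hend] }
  exact (starBundle_isCoveringMap hself hcomp).monodromy_eq_of_map_eq
    (ex := ⟨starSection hself hcomp x f (vertexPt K x), rfl⟩)
    (ey := ⟨starSection hself hcomp y (g x y f) (vertexPt K y), rfl⟩)
    (Path.Homotopic.Quotient.mk Γ) rfl

end StarBundle

end Realization

/-! ### Homotopy invariance of transport along chains -/

variable {X : Type u} [UniformSpace X]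

/-- Transport along a chain in a system `S` of sets, with transition maps `T`. -/
def EChain.transport {E : Set (X × X)} {S : X → Type*}
    (T : ∀ x y, (x, y) ∈ E → S x → S y) {x y : X} : EChain E x y → S x → S y
  | .nil _ => id
  | .cons h c => fun s => c.transport T (T _ _ h s)

/-- Edge by edge, transport is the monodromy of the star bundle along the path of the chain, and
monodromy only sees the homotopy class of a path. -/
theorem EChain.transport_eq_of_transition {E : Entourage X} {F : Type*} {g : X → X → F → F}
    (hself : ∀ v f, g v v f = f)
    (hcomp : ∀ s ∈ (rips E).faces, ∀ u ∈ s, ∀ v ∈ s, ∀ w ∈ s, ∀ f, g v w (g u v f) = g u w f)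
    {x y : X} {c d : EChain E.rel x y} (h : c.toPath.Homotopic d.toPath) (f : F) :
    c.transport (S := fun _ => F) (fun x y _ => g x y) f =
      d.transport (S := fun _ => F) (fun x y _ => g x y) f := by
  let _ : TopologicalSpace F := ⊥
  have : DiscreteTopology F := ⟨rfl⟩
  have key : ∀ {x y : X} (c : EChain E.rel x y) (f : F),
      (starBundle_isCoveringMap hself hcomp).monodromy (Path.Homotopic.Quotient.mk c.toPath)
        ⟨starSection hself hcomp x f (vertexPt _ x), rfl⟩ =
      ⟨starSection hself hcomp y (c.transport (S := fun _ => F) (fun x y _ => g x y) f)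
        (vertexPt _ y), rfl⟩ := by
    intro x y c
    induction c with
    | nil x =>
      intro f
      exact congrFun ((starBundle_isCoveringMap hself hcomp).monodromy_refl) _
    | cons h c ih =>
      intro f
      rw [EChain.toPath, Path.Homotopic.Quotient.mk_trans, IsCoveringMap.monodromy_trans_apply,
        monodromy_edgePath, ih]
      rfl
  have h1 := (key c f).symm.trans ((congrArg (fun q =>
    (starBundle_isCoveringMap hself hcomp).monodromy q _)
      (Path.Homotopic.Quotient.eq.2 h)).trans (key d f))
  have h2 := congrArg (fun z => z.1) h1
  have hi := mem_openStar_iff.1 ((starBundle g hself hcomp).mem_baseSet_at (vertexPt _ y))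
  have hi' : (starBundle g hself hcomp).indexAt (vertexPt _ y) = y :=
      Finset.mem_singleton.1 (Finsupp.support_single_subset hi)
  simp only [starSection, hi', hself] at h2
  exact eq_of_heq (Bundle.TotalSpace.mk.inj h2).2

/-- The transport along a chain in a system of sets whose transition maps are compatible on
triangles depends only on the homotopy class of the chain. -/
theorem EChain.transport_eq_of_homotopic {E : Entourage X} {S : X → Type*}
    {T : ∀ x y, (x, y) ∈ E.rel → S x → S y} (hrefl : ∀ x h s, T x x h s = s)
    (htri : ∀ x y z hxy hyz hxz s, T y z hyz (T x y hxy s) = T x z hxz s)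
    {x y : X} {c d : EChain E.rel x y} (h : c.toPath.Homotopic d.toPath) (s : S x) :
    c.transport T s = d.transport T s := by
  classical
  let eT : ∀ {u v}, (u, v) ∈ E.rel → (S u ≃ S v) := fun {u v} huv =>
    { toFun := T u v huv
      invFun := T v u (E.symm huv)
      left_inv := fun s => by rw [htri _ _ _ _ _ (refl_mem_uniformity E.mem), hrefl]
      right_inv := fun s => by rw [htri _ _ _ _ _ (refl_mem_uniformity E.mem), hrefl] }
  -- The star bundle has a constant fibre, so each `S v` is identified with `S x` by an arbitrary
  -- bijection when one exists; otherwise `e` takes the unused default value `s`. The maps `g` are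
  -- the `T` read through these bijections, and the identity elsewhere.
  let e : ∀ v, S v → S x := fun v t => if h : Nonempty (S v ≃ S x) then h.some t else s
  have he : ∀ v (h : Nonempty (S v ≃ S x)) t, e v t = h.some t := fun v h t => dif_pos h
  let g : X → X → S x → S x := fun u v f =>
    if H : (u, v) ∈ E.rel ∧ Nonempty (S u ≃ S x) then e v (T u v H.1 (H.2.some.symm f)) else f
  have hg : ∀ {u v} (huv : (u, v) ∈ E.rel) (hu : Nonempty (S u ≃ S x)) (t : S u),
      g u v (e u t) = e v (T u v huv t) := fun huv hu t => by
    simp only [g]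
    rw [dif_pos ⟨huv, hu⟩, he _ hu, Equiv.symm_apply_apply]
  have hnon : ∀ {u v}, (u, v) ∈ E.rel → Nonempty (S u ≃ S x) → Nonempty (S v ≃ S x) :=
    fun huv hu => ⟨(eT huv).symm.trans hu.some⟩
  have hsurj : ∀ u, Nonempty (S u ≃ S x) → ∀ f, ∃ t, e u t = f := fun u hu f =>
    ⟨hu.some.symm f, by rw [he _ hu, Equiv.apply_symm_apply]⟩
  have hself : ∀ v f, g v v f = f := by
    intro v f
    by_cases hv : Nonempty (S v ≃ S x)
    · obtain ⟨t, rfl⟩ := hsurj v hv f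
      rw [hg (refl_mem_uniformity E.mem) hv, hrefl]
    · exact dif_neg fun H => hv H.2
  have hcomp : ∀ s ∈ (rips E).faces, ∀ u ∈ s, ∀ v ∈ s, ∀ w ∈ s, ∀ f,
      g v w (g u v f) = g u w f := by
    intro s hs u hu v hv w hw f
    by_cases hS : Nonempty (S u ≃ S x)
    · obtain ⟨t, rfl⟩ := hsurj u hS f
      have huv := hs.2 u hu v hv
      rw [hg huv hS, hg (hs.2 v hv w hw) (hnon huv hS), hg (hs.2 u hu w hw) hS, htri]
    -- The steps `T` are bijections, so within a simplex all fibres or none are in bijection with `S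
    -- x`; in the second case every `g` involved is the identity.
    · have hS' : ¬ Nonempty (S v ≃ S x) := fun h => hS (hnon (hs.2 v hv u hu) h)
      have h1 : g u v f = f := dif_neg fun H => hS H.2
      have h2 : g u w f = f := dif_neg fun H => hS H.2
      have h3 : g v w f = f := dif_neg fun H => hS' H.2
      rw [h1, h2, h3]
  have key : ∀ {u v : X} (c : EChain E.rel u v) (_ : Nonempty (S u ≃ S x)) (t : S u),
      c.transport (S := fun _ => S x) (fun x y _ => g x y) (e u t) = e v (c.transport T t) := by
    intro u v c
    induction c with
    | nil x => intro _ t; rfl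
    | cons h c ih =>
      intro hu t
      simp only [EChain.transport]
      rw [hg h hu, ih (hnon h hu)]
  have hx : Nonempty (S x ≃ S x) := ⟨Equiv.refl _⟩
  have hreach : ∀ {u v : X} (c : EChain E.rel u v), Nonempty (S u ≃ S x) → Nonempty (S v ≃ S x) := by
    intro u v c
    induction c with
    | nil x => exact id
    | cons h c ih => exact fun hu => ih (hnon h hu)
  have h1 := (key c hx s).symm.trans
    ((EChain.transport_eq_of_transition hself hcomp h _).trans (key d hx s))
  rw [he _ (hreach c hx), he _ (hreach c hx)] at h1
  exact (hreach c hx).some.injective h1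

theorem range_toPath_subset {E : Entourage X} {s : Finset X} {x y : X} (c : EChain E.rel x y)
    (hc : ∀ v ∈ c.points, v ∈ s) : Set.range c.toPath ⊆ closedFace (rips E) s := by
  classical
  induction c with
  | nil x =>
    rintro _ ⟨t, rfl⟩
    exact Finsupp.support_single_subset.trans
      (Finset.singleton_subset_iff.2 (hc x (by simp [EChain.points])))
  | @cons x y z h c ih =>
    have hx : x ∈ s := hc x (by simp [EChain.points])
    have hy : y ∈ s := hc y (by cases c <;> simp [EChain.points])
    rw [EChain.toPath, Path.trans_range]
    refine Set.union_subset ?_ (ih fun v hv => hc v (by simp [EChain.points, hv]))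
    rintro _ ⟨t, rfl⟩
    refine (support_edge_subset x y _ _).trans ?_
    intro v hv
    rcases Finset.mem_insert.1 hv with rfl | hv
    · exact hx
    · rwa [Finset.mem_singleton.1 hv]

/-! ### Chain classes in a simplex and local systems -/

namespace ChainClass

variable {E : Entourage X}

/-- Two chains in a simplex with the same endpoints are homotopic. -/
theorem mk_eq_of_mem_face {x y : X} (c d : EChain E.rel x y) {s : Finset X}
    (hs : s ∈ (rips E).faces) (hc : ∀ v ∈ c.points, v ∈ s) (hd : ∀ v ∈ d.points, v ∈ s) :
    mk c = mk d :=
  mk_eq.2 (homotopic_of_support_subset _ _ hs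
    (fun t => range_toPath_subset c hc ⟨t, rfl⟩) fun t => range_toPath_subset d hd ⟨t, rfl⟩)

/-- The class of a chain with one edge. -/
def edge {x y : X} (h : (x, y) ∈ E.rel) : ChainClass E x y := mk (.cons h (.nil y))

theorem edge_self {x : X} (h : (x, x) ∈ E.rel) : edge h = refl E x :=
  mk_eq_of_mem_face _ _ ((rips E).singleton_mem x) (by simp [EChain.points])
    (by simp [EChain.points])

/-- The three points form a simplex of the Rips complex, which fills the triangle. -/
theorem edge_trans_edge {x y z : X} (hxy : (x, y) ∈ E.rel) (hyz : (y, z) ∈ E.rel)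
    (hxz : (x, z) ∈ E.rel) : (edge hxy).trans (edge hyz) = edge hxz := by
  classical
  have hr : ∀ a : X, (a, a) ∈ E.rel := fun a => refl_mem_uniformity E.mem
  refine mk_eq_of_mem_face (s := {x, y, z}) _ _ ⟨⟨x, by simp⟩, fun a ha b hb => ?_⟩
    (by simp [EChain.points, EChain.append]) (by simp [EChain.points])
  simp only [Finset.mem_insert, Finset.mem_singleton] at ha hb
  rcases ha with rfl | rfl | rfl <;> rcases hb with rfl | rfl | rfl <;>
    first | exact hr _ | assumption | exact E.symm (by assumption)

theorem coarsen_coarsen {E' E'' : Entourage X} (h : E.rel ⊆ E'.rel) (h' : E'.rel ⊆ E''.rel)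
    {x y : X} (a : ChainClass E x y) : (a.coarsen h).coarsen h' = a.coarsen (h.trans h') := by
  induction a using Quotient.inductionOn with | _ a
  exact congrArg mk (EChain.map_map id id (fun hp => h hp) (fun hp => h' hp) a)

theorem coarsen_trans {E' : Entourage X} (h : E.rel ⊆ E'.rel) {x y z : X}
    (a : ChainClass E x y) (b : ChainClass E y z) :
    (a.trans b).coarsen h = (a.coarsen h).trans (b.coarsen h) :=
  map_trans id (fun hp => h hp) a b

end ChainClass

/-- A system of sets indexed by the points of `X`, with transition maps along `E` that are
compatible on triangles. -/
structure LocalSystem (E : Entourage X) where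
  fibre : X → Type u
  step : ∀ x y, (x, y) ∈ E.rel → fibre x → fibre y
  step_self : ∀ x h s, step x x h s = s
  step_step : ∀ x y z hxy hyz hxz s, step y z hyz (step x y hxy s) = step x z hxz s

/-- Transport in a local system along a homotopy class of chains. -/
def ChainClass.transport {E : Entourage X} (S : LocalSystem E) {x y : X} (a : ChainClass E x y) :
    S.fibre x → S.fibre y :=
  Quotient.lift (s := chainSetoid E x y) (fun c => c.transport S.step) (fun _ _ h => funext fun s =>
    EChain.transport_eq_of_homotopic S.step_self S.step_step h s) a

/-- The intersection of two symmetric entourages. -/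
def Entourage.inter (E F : Entourage X) : Entourage X where
  rel := E.rel ∩ F.rel
  mem := Filter.inter_mem E.mem F.mem
  symm h := ⟨E.symm h.1, F.symm h.2⟩

theorem Entourage.exists_subset {s : Set (X × X)} (hs : s ∈ 𝓤 X) : ∃ E : Entourage X, E.rel ⊆ s :=
  ⟨⟨s ∩ Prod.swap ⁻¹' s, Filter.inter_mem hs (symm_le_uniformity hs), fun h => ⟨h.2, h.1⟩⟩,
    Set.inter_subset_left⟩

/-! ### Lifting of generalized paths -/

section Lifting

variable {Z : Type u} [UniformSpace Z] {f : Z → X}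

/-- `E`-steps over `G`-steps exist, and two consecutive ones are determined by the endpoint. -/
structure LiftingPair (f : Z → X) (E : Entourage Z) (G : Entourage X) : Prop where
  unique : ∀ {a b c d : Z}, (a, b) ∈ E.rel → (b, c) ∈ E.rel → (a, d) ∈ E.rel → f c = f d → c = d
  lift : ∀ {z : Z} {y : X}, (f z, y) ∈ G.rel → ∃ z', (z, z') ∈ E.rel ∧ f z' = y

theorem LiftingPair.unique' {E : Entourage Z} {G : Entourage X} (hp : LiftingPair f E G)
    {a c d : Z} (hc : (a, c) ∈ E.rel) (hd : (a, d) ∈ E.rel) (h : f c = f d) : c = d :=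
  hp.unique (refl_mem_uniformity E.mem) hc hd h

/-- Unique lifting for `F`-chains is applied to an `E` with `E ∘ E ⊆ F`, so that two consecutive
`E`-steps amount to one `F`-step. Chain lifting for chains of one edge supplies `G`. -/
theorem IsUniformCoveringMap.exists_liftingPair (hf : IsUniformCoveringMap f) {s : Set (Z × Z)}
    (hs : s ∈ 𝓤 Z) : ∃ E G, LiftingPair f E G ∧ E.rel ⊆ s := by
  obtain ⟨F, hF, -, hF'⟩ := hf.uniqueChainLifts Set.univ Filter.univ_mem
  obtain ⟨t, ht, htF⟩ := comp_mem_uniformity_sets hF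
  obtain ⟨E, hE⟩ := Entourage.exists_subset (Filter.inter_mem ht hs)
  obtain ⟨D, hD, hD'⟩ := hf.chainLifting E.rel E.mem
  obtain ⟨G, hG⟩ := Entourage.exists_subset (hf.generates.2 D hD)
  refine ⟨E, G, ⟨fun {a b c d} hab hbc had hcd => ?_, fun {z y} hzy => ?_⟩,
    hE.trans Set.inter_subset_right⟩
  · have h1 : (a, c) ∈ F := htF ⟨b, (hE hab).1, (hE hbc).1⟩
    have h2 : (a, d) ∈ F := htF ⟨a, refl_mem_uniformity ht, (hE had).1⟩
    have := hF' a c d (.cons h1 (.nil c)) (.cons h2 (.nil d)) (by simp [EChain.points, hcd])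
    simpa [EChain.points] using this
  · obtain ⟨z', d, hd⟩ := hD' z y (.cons (hG hzy) (.nil y))
    match d, hd with
    | .cons h (.nil _), hd => exact ⟨_, h, by simpa [EChain.points] using hd⟩
    | .cons _ (.cons _ c), hd => cases c <;> simp [EChain.points] at hd

namespace LiftingPair

variable {E E' : Entourage Z} {G G' : Entourage X}

/-- The points over `x` with a homotopy class of chains from `z`. -/
abbrev Fibre (f : Z → X) (E : Entourage Z) (z : Z) (x : X) : Type u :=
  Σ w : {w // f w = x}, ChainClass E z w

/-- Prolongation of a chain by the lift of a step. -/
noncomputable def step (hp : LiftingPair f E G) (z : Z) (x y : X) (h : (x, y) ∈ G.rel)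
    (s : Fibre f E z x) : Fibre f E z y :=
  have h' : ∃ z', (s.1.1, z') ∈ E.rel ∧ f z' = y := hp.lift (by rwa [s.1.2])
  ⟨⟨h'.choose, h'.choose_spec.2⟩, s.2.trans (.edge h'.choose_spec.1)⟩

/-- By uniqueness of lifted steps, the choice made in `step` is immaterial and any lift may replace
it. -/
theorem step_eq (hp : LiftingPair f E G) {z : Z} {x y : X} (h : (x, y) ∈ G.rel)
    {w w' : Z} (hw : f w = x) (hw' : f w' = y) (hE : (w, w') ∈ E.rel) (c : ChainClass E z w) :
    hp.step z x y h ⟨⟨w, hw⟩, c⟩ = ⟨⟨w', hw'⟩, c.trans (.edge hE)⟩ := by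
  have h' : ∃ z', (w, z') ∈ E.rel ∧ f z' = y := hp.lift (by rwa [hw])
  have : h'.choose = w' :=
    hp.unique' h'.choose_spec.1 hE (h'.choose_spec.2.trans hw'.symm)
  subst this
  rfl

theorem exists_step_eq (hp : LiftingPair f E G) {z : Z} {x y : X} (h : (x, y) ∈ G.rel)
    (s : Fibre f E z x) : ∃ w', ∃ hw' : f w' = y, ∃ hE : (s.1.1, w') ∈ E.rel,
      hp.step z x y h s = ⟨⟨w', hw'⟩, s.2.trans (.edge hE)⟩ := by
  obtain ⟨w', hE, hw'⟩ := hp.lift (z := s.1.1) (y := y) (by rwa [s.1.2])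
  exact ⟨w', hw', hE, hp.step_eq h s.1.2 hw' hE s.2⟩

/-- The local system of lifts of chains to `Z` starting at `z`. -/
noncomputable def system (hp : LiftingPair f E G) (z : Z) : LocalSystem G where
  fibre := Fibre f E z
  step := hp.step z
  step_self := by
    rintro x h ⟨⟨w, hw⟩, c⟩
    rw [hp.step_eq h hw hw (refl_mem_uniformity E.mem), ChainClass.edge_self,
      ChainClass.trans_refl]
  step_step := by
    rintro x y v hxy hyv hxv ⟨⟨w, hw⟩, c⟩
    obtain ⟨w₁, hw₁, h₁, e₁⟩ := hp.exists_step_eq hxy ⟨⟨w, hw⟩, c⟩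
    obtain ⟨w₂, hw₂, h₂, e₂⟩ := hp.exists_step_eq hyv ⟨⟨w₁, hw₁⟩, c.trans (.edge h₁)⟩
    obtain ⟨w₃, hw₃, h₃, e₃⟩ := hp.exists_step_eq hxv ⟨⟨w, hw⟩, c⟩
    -- The lifted triangle closes up: this is why uniqueness is required after two consecutive steps
    -- and not only after one.
    have : w₂ = w₃ := hp.unique h₁ h₂ h₃ (hw₂.trans hw₃.symm)
    subst this
    rw [e₁, e₂, e₃, ChainClass.trans_assoc, ChainClass.edge_trans_edge h₁ h₂ h₃]

/-- The endpoint of the lift of a generalized path, with the class of the lifted chain. -/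
noncomputable def liftEnd (hp : LiftingPair f E G) (z : Z) {y : X} (α : GenPath (f z) y) :
    Fibre f E z y :=
  (α.term G).transport (hp.system z) ⟨⟨z, rfl⟩, .refl E z⟩

/-- A chain upstairs with small enough steps is itself the lift of its image. -/
theorem transport_map_step (hp : LiftingPair f E G) (z : Z) {R : Set (Z × Z)} {a b : Z}
    (c : EChain R a b) (hE : ∀ {x y}, (x, y) ∈ R → (x, y) ∈ E.rel)
    (hG : ∀ {x y}, (x, y) ∈ R → (f x, f y) ∈ G.rel) (d : ChainClass E z a) :
    (c.map f hG).transport (hp.step z) ⟨⟨a, rfl⟩, d⟩ =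
      ⟨⟨b, rfl⟩, d.trans (.mk (c.map id hE))⟩ := by
  induction c with
  | nil x => exact congrArg (Sigma.mk _) (ChainClass.trans_refl d).symm
  | cons h c ih =>
    simp only [EChain.map, EChain.transport]
    rw [hp.step_eq _ rfl rfl (hE h), ih, ChainClass.trans_assoc]
    rfl

/-- Taken at the intersection of two entourages, this gives one chain representing both terms, which
reduces the comparisons below to inductions on a chain. -/
theorem _root_.UniformCovering.GenPath.exists_chain {x y : X} (α : GenPath x y) (E : Entourage X) :
    ∃ c : EChain E.rel x y, ∀ (F : Entourage X) (h : E.rel ⊆ F.rel),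
      α.term F = .mk (c.map id fun hp => h hp) := by
  obtain ⟨c, hc⟩ := Quotient.exists_rep (α.term E)
  refine ⟨c, fun F h => ?_⟩
  rw [← α.compat E F h, ← hc]
  rfl

theorem liftEnd_map (hp : LiftingPair f E G) (hf : UniformContinuous f) {z w : Z}
    (β : GenPath z w) : hp.liftEnd z (β.map f hf) = ⟨⟨w, rfl⟩, β.term E⟩ := by
  obtain ⟨c, hc⟩ := β.exists_chain (E.inter (G.comap f hf))
  have h1 : (β.map f hf).term G = .mk (c.map f fun h => h.2) := by
    change (β.term (G.comap f hf)).map f _ = _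
    rw [hc _ Set.inter_subset_right]
    exact congrArg ChainClass.mk (EChain.map_map id f _ _ c)
  rw [liftEnd, h1, hc E Set.inter_subset_left]
  exact (hp.transport_map_step z c (fun h => h.1) _ _).trans
    (congrArg (Sigma.mk _) (ChainClass.refl_trans _))

/-- A chain fine for both `G` and `G'` is lifted by `E'`-steps. These are also `E`-steps, so by
uniqueness both pairs lift it to the same points. -/
theorem liftEnd_coarsen (hp : LiftingPair f E G) (hp' : LiftingPair f E' G')
    (h : E'.rel ⊆ E.rel) {z : Z} {y : X} (α : GenPath (f z) y) :
    hp.liftEnd z α = ⟨(hp'.liftEnd z α).1, (hp'.liftEnd z α).2.coarsen h⟩ := by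
  have key : ∀ {x y : X} (c : EChain (G.inter G').rel x y) (s : Fibre f E' z x),
      (c.map id fun h => h.1 : EChain G.rel x y).transport (hp.step z) ⟨s.1, s.2.coarsen h⟩ =
      ⟨((c.map id fun h => h.2 : EChain G'.rel x y).transport (hp'.step z) s).1,
        ((c.map id fun h => h.2 : EChain G'.rel x y).transport (hp'.step z) s).2.coarsen h⟩ := by
    intro x y c
    induction c with
    | nil x => intro s; rfl
    | cons hxy c ih =>
      intro s
      obtain ⟨w', hw', hE, e⟩ := hp'.exists_step_eq hxy.2 s
      have e' := hp.step_eq hxy.1 s.1.2 hw' (h hE) (s.2.coarsen h)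
      simp only [EChain.map, EChain.transport, id] at ih ⊢
      rw [e, ← ih]
      refine congrArg _ (e'.trans ?_)
      exact congrArg (Sigma.mk _) (ChainClass.coarsen_trans h s.2 (.edge hE)).symm
  obtain ⟨c, hc⟩ := α.exists_chain (G.inter G')
  rw [liftEnd, liftEnd, hc G Set.inter_subset_left, hc G' Set.inter_subset_right]
  exact key c ⟨⟨z, rfl⟩, .refl E' z⟩

/-- The image of a chain class with endpoint over `y`. -/
def Fibre.map {z : Z} {y : X} (D : Entourage X) (h : ∀ {a b}, (a, b) ∈ E.rel → (f a, f b) ∈ D.rel)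
    (s : Fibre f E z y) : ChainClass D (f z) y :=
  s.1.2 ▸ s.2.map f h

theorem Fibre.map_liftEnd (hp : LiftingPair f E G) (D : Entourage X)
    (h : ∀ {a b}, (a, b) ∈ E.rel → (f a, f b) ∈ D.rel) {z : Z} {y : X} (α : GenPath (f z) y) :
    Fibre.map D h (hp.liftEnd z α) = α.term D := by
  have key : ∀ {x y : X} (c : EChain (G.inter D).rel x y) (s : Fibre f E z x),
      Fibre.map D h ((c.map id fun h => h.1 : EChain G.rel x y).transport (hp.step z) s) =
        (Fibre.map D h s).trans (.mk (c.map id fun h => h.2)) := by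
    intro x y c
    induction c with
    | nil x => intro s; exact (ChainClass.trans_refl _).symm
    | cons hxy c ih =>
      intro s
      refine (ih _).trans ?_
      have e : Fibre.map D h (hp.step z _ _ hxy.1 s) =
          (Fibre.map D h s).trans (.edge hxy.2) := by
        obtain ⟨w', rfl, hE, e⟩ := hp.exists_step_eq hxy.1 s
        rw [e]
        obtain ⟨⟨w, rfl⟩, d⟩ := s
        exact ChainClass.map_trans f h d (.edge hE)
      change (Fibre.map D h (hp.step z _ _ hxy.1 s)).trans _ = _
      rw [e, ChainClass.trans_assoc]
      rfl
  obtain ⟨c, hc⟩ := α.exists_chain (G.inter D)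
  rw [liftEnd, hc G Set.inter_subset_left, hc D Set.inter_subset_right]
  exact (key c _).trans (ChainClass.refl_trans _)

end LiftingPair

/-! ### Lifts of generalized paths: existence and uniqueness of the endpoint -/

/-- `Lifts f hf α z z'`: the generalized path `α` has a lift from `z` to `z'`. -/
inductive Lifts (f : Z → X) (hf : UniformContinuous f) :
    ∀ {x y : X}, GenPath x y → Z → Z → Prop
  | map {z z' : Z} (β : GenPath z z') : Lifts f hf (β.map f hf) z z'

variable {hu : UniformContinuous f}

/-- Any two lifting pairs have a common refinement, so `liftEnd_coarsen` shows that they give the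
same endpoint and compatible chain classes; the lifted path is assembled from these classes. -/
theorem IsUniformCoveringMap.exists_lifts (hf : IsUniformCoveringMap f) {x y : X} {z : Z}
    (hz : f z = x) (α : GenPath x y) : ∃ z', Lifts f hu α z z' := by
  subst hz
  obtain ⟨w, hw⟩ : ∃ w : {w // f w = y}, ∀ (E : Entourage Z) (G : Entourage X)
      (hp : LiftingPair f E G), ∃ c, hp.liftEnd z α = ⟨w, c⟩ := by
    obtain ⟨E₀, G₀, hp₀, -⟩ := hf.exists_liftingPair Filter.univ_mem
    refine ⟨(hp₀.liftEnd z α).1, fun E G hp => ?_⟩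
    obtain ⟨E₁, G₁, hp₁, h₁⟩ := hf.exists_liftingPair (E₀.inter E).mem
    rw [hp.liftEnd_coarsen hp₁ (h₁.trans Set.inter_subset_right),
      hp₀.liftEnd_coarsen hp₁ (h₁.trans Set.inter_subset_left)]
    exact ⟨_, rfl⟩
  obtain ⟨w, rfl⟩ := w
  -- The `E`-term of the lift is the coarsening of the class found by any lifting pair whose
  -- entourage lies in `E`.
  have hterm : ∀ E : Entourage Z, ∃ t : ChainClass E z w, ∀ (E₁ : Entourage Z) (G₁ : Entourage X)
      (hp : LiftingPair f E₁ G₁) (h : E₁.rel ⊆ E.rel) (c : ChainClass E₁ z w),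
      hp.liftEnd z α = ⟨⟨w, rfl⟩, c⟩ → c.coarsen h = t := by
    intro E
    obtain ⟨E₂, G₂, hp₂, h₂⟩ := hf.exists_liftingPair E.mem
    obtain ⟨c₂, hc₂⟩ := hw E₂ G₂ hp₂
    refine ⟨c₂.coarsen h₂, fun E₁ G₁ hp₁ h₁ c₁ hc₁ => ?_⟩
    obtain ⟨E₃, G₃, hp₃, h₃⟩ := hf.exists_liftingPair (E₁.inter E₂).mem
    obtain ⟨c₃, hc₃⟩ := hw E₃ G₃ hp₃
    rw [hp₁.liftEnd_coarsen hp₃ (h₃.trans Set.inter_subset_left), hc₃] at hc₁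
    rw [hp₂.liftEnd_coarsen hp₃ (h₃.trans Set.inter_subset_right), hc₃] at hc₂
    rw [← eq_of_heq (Sigma.mk.inj hc₁).2, ← eq_of_heq (Sigma.mk.inj hc₂).2,
      ChainClass.coarsen_coarsen, ChainClass.coarsen_coarsen]
  choose term hterm using hterm
  let β : GenPath z w :=
    { term := term
      compat := fun F E h => by
        obtain ⟨E₁, G₁, hp₁, h₁⟩ := hf.exists_liftingPair F.mem
        obtain ⟨c, hc⟩ := hw E₁ G₁ hp₁
        rw [← hterm F E₁ G₁ hp₁ h₁ c hc, ← hterm E E₁ G₁ hp₁ (h₁.trans h) c hc,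
          ChainClass.coarsen_coarsen] }
  have hβ : β.map f hu = α := by
    refine GenPath.ext (funext fun D => ?_)
    obtain ⟨E₁, G₁, hp₁, h₁⟩ := hf.exists_liftingPair (D.comap f hu).mem
    obtain ⟨c, hc'⟩ := hw E₁ G₁ hp₁
    change (term (D.comap f hu)).map f _ = α.term D
    rw [← hterm _ E₁ G₁ hp₁ h₁ c hc', ← LiftingPair.Fibre.map_liftEnd hp₁ D (fun h => h₁ h) α, hc']
    induction c using Quotient.inductionOn with | _ c
    exact congrArg ChainClass.mk (EChain.map_map id f _ _ c)
  exact ⟨w, hβ ▸ Lifts.map β⟩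

namespace Lifts

variable {x y v : X} {α : GenPath x y} {β : GenPath y v} {z z' z'' : Z}

theorem proj_left (h : Lifts f hu α z z') : f z = x := by cases h; rfl

theorem proj_right (h : Lifts f hu α z z') : f z' = y := by cases h; rfl

/-- The endpoints are indices of `Lifts`, which obstructs case analysis once they are already of the
form `f z`. The heterogeneous equality becomes an equality after substituting the endpoints. -/
theorem exists_map_heq (h : Lifts f hu α z z') :
    ∃ β : GenPath z z', f z = x ∧ f z' = y ∧ β.map f hu ≍ α := by
  obtain ⟨β⟩ := h
  exact ⟨β, rfl, rfl, HEq.rfl⟩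

theorem refl (f : Z → X) (hu : UniformContinuous f) {x : X} {z : Z} (h : f z = x) :
    Lifts f hu (.refl x) z z := by
  subst h
  exact .map (.refl z)

theorem symm (h : Lifts f hu α z z') : Lifts f hu α.symm z' z := by
  obtain ⟨β⟩ := h
  have : (β.map f hu).symm = β.symm.map f hu := GenPath.ext (funext fun E =>
    (ChainClass.map_symm f (fun h => h) (β.term (E.comap f hu))).symm)
  rw [this]
  exact .map β.symm

theorem trans (h : Lifts f hu α z z') (h' : Lifts f hu β z' z'') :
    Lifts f hu (α.trans β) z z'' := by
  obtain ⟨α'⟩ := h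
  obtain ⟨β', -, rfl, hβ⟩ := h'.exists_map_heq
  obtain rfl := eq_of_heq hβ
  have : (α'.map f hu).trans (β'.map f hu) = (α'.trans β').map f hu :=
    GenPath.ext (funext fun E => (ChainClass.map_trans f (fun h => h)
      (α'.term (E.comap f hu)) (β'.term (E.comap f hu))).symm)
  rw [this]
  exact .map _

theorem liftEnd_fst {E : Entourage Z} {G : Entourage X} (hp : LiftingPair f E G)
    {α : GenPath (f z) y} (h : Lifts f hu α z z') : (hp.liftEnd z α).1.1 = z' := by
  obtain ⟨β', -, rfl, hβ⟩ := h.exists_map_heq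
  obtain rfl := eq_of_heq hβ
  rw [hp.liftEnd_map]

/-- The endpoint of any lift is computed by `liftEnd`, which depends only on `α` and the starting
point. -/
theorem unique (hf : IsUniformCoveringMap f) (h : Lifts f hu α z z') (h' : Lifts f hu α z z'') :
    z' = z'' := by
  obtain ⟨E, G, hp, -⟩ := hf.exists_liftingPair Filter.univ_mem
  obtain rfl := h.proj_left
  rw [← h.liftEnd_fst hp, ← h'.liftEnd_fst hp]

/-- The `G`-term is a single edge, so its lift is a single `E`-step. -/
theorem mem_of_isShort {E : Entourage Z} {G : Entourage X} (hp : LiftingPair f E G)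
    (h : Lifts f hu α z z') (hα : α.IsShort G) : (z, z') ∈ E.rel := by
  obtain rfl := h.proj_left
  obtain ⟨hG, hα⟩ := hα
  have h1 := h.liftEnd_fst hp
  rw [LiftingPair.liftEnd, hα] at h1
  change (hp.step z _ _ hG ⟨⟨z, rfl⟩, .refl E z⟩).1.1 = z' at h1
  obtain ⟨w, hw, hE, e⟩ := hp.exists_step_eq hG ⟨⟨z, rfl⟩, .refl E z⟩
  rw [e] at h1
  exact h1 ▸ hE

theorem comp {W : Type u} [UniformSpace W] {g : W → X} {k : Z → W} (hk : UniformContinuous k)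
    (hg : UniformContinuous g) (hfk : f = g ∘ k) (h : Lifts f hu α z z') :
    Lifts g hg α (k z) (k z') := by
  subst hfk
  obtain ⟨β⟩ := h
  have : β.map (g ∘ k) hu = (β.map k hk).map g hg := GenPath.ext (funext fun E => by
    change (β.term ((E.comap g hg).comap k hk)).map (g ∘ k) _ =
      ((β.term ((E.comap g hg).comap k hk)).map k _).map g _
    generalize β.term ((E.comap g hg).comap k hk) = a
    induction a using Quotient.inductionOn with | _ a
    exact (congrArg ChainClass.mk (EChain.map_map k g (fun h => h) (fun h => h) a)).symm)
  rw [this]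
  exact .map (β.map k hk)

end Lifts

theorem UnifPi1.mem_image_iff {z : Z} {x : X} (h : f z = x) (α : UnifPi1 X x) :
    α ∈ UnifPi1.image f hu h ↔ Lifts f hu (x := x) (y := x) α z z := by
  subst h
  constructor
  · rintro ⟨β, rfl⟩
    exact .map β
  · intro h
    obtain ⟨β, -, -, hβ⟩ := h.exists_map_heq
    exact ⟨β, eq_of_heq hβ⟩

end Lifting

/-! ### Short generalized paths -/

theorem ChainClass.trans_symm {E : Entourage X} {x y : X} (a : ChainClass E x y) :
    a.trans a.symm = refl E x := by
  induction a using Quotient.inductionOn with | _ a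
  exact mk_eq.2 ((toPath_append _ _).trans (((Path.Homotopic.refl _).hcomp (toPath_reverse _)).trans
    (Path.Homotopic.trans_symm _)))

namespace GenPath

variable {x y z w : X}

theorem trans_assoc (a : GenPath x y) (b : GenPath y z) (c : GenPath z w) :
    (a.trans b).trans c = a.trans (b.trans c) :=
  GenPath.ext (funext fun _ => ChainClass.trans_assoc _ _ _)

theorem refl_trans (a : GenPath x y) : (refl x).trans a = a :=
  GenPath.ext (funext fun _ => ChainClass.refl_trans _)

theorem trans_refl (a : GenPath x y) : a.trans (refl y) = a :=
  GenPath.ext (funext fun _ => ChainClass.trans_refl _)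

theorem symm_trans (a : GenPath x y) : a.symm.trans a = refl y :=
  GenPath.ext (funext fun _ => ChainClass.symm_trans _)

theorem trans_symm (a : GenPath x y) : a.trans a.symm = refl x :=
  GenPath.ext (funext fun _ => ChainClass.trans_symm _)

theorem trans_symm_cancel_right (a : GenPath x y) (b : GenPath z y) :
    (a.trans b.symm).trans b = a := by
  rw [trans_assoc, symm_trans, trans_refl]

theorem trans_cancel_right (a : GenPath x y) (b : GenPath y z) :
    (a.trans b).trans b.symm = a := by
  rw [trans_assoc, trans_symm, trans_refl]

/-- A generalized path is determined by one term, if loops with trivial term are trivial. -/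
theorem eq_of_term_eq {E : Entourage X}
    (hE : ∀ (x : X) (a : GenPath x x), a.term E = ChainClass.refl E x → a = refl x)
    {a b : GenPath x y} (h : a.term E = b.term E) : a = b := by
  have h1 : a.trans b.symm = refl x := hE x _ (by
    change (a.term E).trans (b.term E).symm = _
    rw [h, ChainClass.trans_symm])
  rw [← trans_symm_cancel_right a b, h1, refl_trans]

theorem isShort_refl (E : Entourage X) (x : X) : (refl x).IsShort E :=
  ⟨refl_mem_uniformity E.mem, (ChainClass.edge_self _).symm⟩

theorem IsShort.symm {E : Entourage X} {a : GenPath x y} (h : a.IsShort E) :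
    a.symm.IsShort E := by
  obtain ⟨h, ha⟩ := h
  refine ⟨E.symm h, ?_⟩
  change (a.term E).symm = _
  rw [ha]
  rfl

theorem IsShort.mono {E F : Entourage X} (hEF : E.rel ⊆ F.rel) {a : GenPath x y}
    (h : a.IsShort E) : a.IsShort F := by
  obtain ⟨h, ha⟩ := h
  refine ⟨hEF h, ?_⟩
  rw [← a.compat E F hEF, ha]
  rfl

theorem IsShort.trans {E : Entourage X} {a : GenPath x y} {b : GenPath y z} (ha : a.IsShort E)
    (hb : b.IsShort E) (h : (x, z) ∈ E.rel) : (a.trans b).IsShort E := by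
  obtain ⟨hxy, ha⟩ := ha
  obtain ⟨hyz, hb⟩ := hb
  refine ⟨h, ?_⟩
  change (a.term E).trans (b.term E) = _
  rw [ha, hb]
  exact ChainClass.edge_trans_edge hxy hyz h

/-- Short generalized paths over the steps of a chain compose to a generalized path. -/
theorem exists_of_chain {E F : Entourage X} (hFE : F.rel ⊆ E.rel)
    (hF : ∀ x y : X, (x, y) ∈ F.rel → ∃ a : GenPath x y, a.IsShort E)
    {P : ∀ y, GenPath x y → Prop}
    (hP : ∀ y z (a : GenPath x y) (b : GenPath y z), b.IsShort E → P y a → P z (a.trans b))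
    (c : EChain F.rel y z) (a : GenPath x y) (ha : P y a) :
    ∃ b : GenPath y z, b.term E = .mk (c.map id fun h => hFE h) ∧ P z (a.trans b) := by
  induction c with
  | nil y => exact ⟨refl y, rfl, by rwa [trans_refl]⟩
  | cons h c ih =>
    obtain ⟨b, hb⟩ := hF _ _ h
    obtain ⟨b', hb', hP'⟩ := ih (a.trans b) (hP _ _ a b hb ha)
    refine ⟨b.trans b', ?_, by rwa [← trans_assoc]⟩
    obtain ⟨hE, hb⟩ := hb
    change (b.term E).trans (b'.term E) = _
    rw [hb, hb']
    rfl

/-- A fine chain representing `a` is replaced, edge by edge, by short generalized paths. Their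
product has the same term as `a` at an entourage that determines generalized paths, hence equals
`a`. -/
theorem short_induction (hjoin : LocallyUniformJoinable X)
    (hsemi : SemilocallySimplyUniformJoinable X) (E : Entourage X)
    {P : ∀ y, GenPath x y → Prop} (hrefl : P x (refl x))
    (hP : ∀ y z (a : GenPath x y) (b : GenPath y z), b.IsShort E → P y a → P z (a.trans b))
    (a : GenPath x y) : P y a := by
  obtain ⟨E₀, hE₀⟩ := hsemi
  obtain ⟨F, hFE, hF⟩ := hjoin (E.inter E₀)
  obtain ⟨c, hc⟩ := a.exists_chain F
  obtain ⟨b, hb, hPb⟩ := exists_of_chain hFE hF (P := P)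
    (fun y z a b h => hP y z a b (h.mono Set.inter_subset_left)) c (refl x) hrefl
  rw [← hc _ hFE] at hb
  have hab : a = b := eq_of_term_eq hE₀ (by
    have h : (E.inter E₀).rel ⊆ E₀.rel := Set.inter_subset_right
    rw [← a.compat _ E₀ h, ← b.compat _ E₀ h]
    exact congrArg _ hb.symm)
  rw [hab]
  rwa [refl_trans] at hPb

theorem nonempty (hjoin : LocallyUniformJoinable X) (hchain : ChainConnected X) (x y : X) :
    Nonempty (GenPath x y) := by
  obtain ⟨F, hFE, hF⟩ := hjoin ⟨Set.univ, Filter.univ_mem, fun _ => trivial⟩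
  obtain ⟨c⟩ := hchain F.rel F.mem x y
  obtain ⟨b, -⟩ := exists_of_chain hFE hF (P := fun _ _ => True) (fun _ _ _ _ _ _ => trivial) c
    (refl x) trivial
  exact ⟨b⟩

end GenPath

/-! ### The covering associated with a subgroup -/

section CoverSpace

variable {x₀ : X}

/-- Two generalized paths from `x₀` are identified if they differ by an element of `H`. -/
def coverSetoid (H : Subgroup (UnifPi1 X x₀)) : Setoid (Σ x, GenPath x₀ x) where
  r a b := ∃ h ∈ H, (⟨a.1, GenPath.trans h a.2⟩ : Σ x, GenPath x₀ x) = b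
  iseqv := by
    refine ⟨fun a => ⟨1, H.one_mem, congrArg (Sigma.mk _) (GenPath.refl_trans a.2)⟩, ?_, ?_⟩
    · rintro a _ ⟨h, hh, rfl⟩
      refine ⟨h⁻¹, H.inv_mem hh, congrArg (Sigma.mk _) ?_⟩
      refine (GenPath.trans_assoc _ _ _).symm.trans ?_
      exact (congrArg (GenPath.trans · a.2) (GenPath.symm_trans h)).trans (GenPath.refl_trans _)
    · rintro a _ _ ⟨h, hh, rfl⟩ ⟨k, hk, rfl⟩
      exact ⟨k * h, H.mul_mem hk hh, congrArg (Sigma.mk _) (GenPath.trans_assoc _ _ _)⟩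

/-- The set of generalized paths from `x₀` modulo `H`. -/
def CoverSpace (H : Subgroup (UnifPi1 X x₀)) : Type u := Quotient (coverSetoid H)

namespace CoverSpace

variable {H : Subgroup (UnifPi1 X x₀)} {x y : X}

/-- The class of a generalized path. -/
def mk (H : Subgroup (UnifPi1 X x₀)) (α : GenPath x₀ x) : CoverSpace H :=
  Quotient.mk (coverSetoid H) ⟨x, α⟩

theorem exists_mk (a : CoverSpace H) : ∃ (x : X) (α : GenPath x₀ x), mk H α = a := by
  obtain ⟨⟨x, α⟩, rfl⟩ := Quotient.exists_rep a
  exact ⟨x, α, rfl⟩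

/-- The endpoint projection. -/
def proj (H : Subgroup (UnifPi1 X x₀)) : CoverSpace H → X :=
  Quotient.lift (fun a => a.1) fun _ _ h => by
    obtain ⟨_, _, rfl⟩ := h
    rfl

@[simp]
theorem proj_mk (α : GenPath x₀ x) : proj H (mk H α) = x := rfl

theorem mk_eq_iff {α β : GenPath x₀ x} : mk H α = mk H β ↔ ∃ h ∈ H, GenPath.trans h α = β := by
  refine Quotient.eq.trans ⟨?_, ?_⟩
  · rintro ⟨h, hh, e⟩
    exact ⟨h, hh, eq_of_heq (Sigma.mk.inj e).2⟩
  · rintro ⟨h, hh, rfl⟩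
    exact ⟨h, hh, rfl⟩

/-- The pairs of classes that differ by an `E`-short generalized path. -/
def rel (H : Subgroup (UnifPi1 X x₀)) (E : Entourage X) : Set (CoverSpace H × CoverSpace H) :=
  {p | ∃ (x y : X) (α : GenPath x₀ x) (γ : GenPath x y), γ.IsShort E ∧
    (mk H α, mk H (α.trans γ)) = p}

theorem mk_mem_rel {E : Entourage X} (α : GenPath x₀ x) {γ : GenPath x y} (hγ : γ.IsShort E) :
    (mk H α, mk H (α.trans γ)) ∈ rel H E := ⟨x, y, α, γ, hγ, rfl⟩

/-- Elements of `H` act on the left and short paths are attached on the right, so the representative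
of the first class can be prescribed. -/
theorem mem_rel_iff {E : Entourage X} {α : GenPath x₀ x} {b : CoverSpace H} :
    (mk H α, b) ∈ rel H E ↔
      ∃ (y : X) (γ : GenPath x y), γ.IsShort E ∧ mk H (α.trans γ) = b := by
  constructor
  · rintro ⟨x', y, α', γ, hγ, e⟩
    obtain ⟨e', rfl⟩ := Prod.mk.inj e
    have hx : x' = x := congrArg (proj H) e'
    subst hx
    obtain ⟨h, hh, rfl⟩ := mk_eq_iff.1 e'
    exact ⟨y, γ, hγ, (mk_eq_iff.2 ⟨h, hh, (GenPath.trans_assoc _ _ _).symm⟩).symm⟩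
  · rintro ⟨y, γ, hγ, rfl⟩
    exact mk_mem_rel α hγ

theorem rel_mono {E F : Entourage X} (h : E.rel ⊆ F.rel) : rel H E ⊆ rel H F := by
  rintro _ ⟨x, y, α, γ, hγ, rfl⟩
  exact mk_mem_rel α (hγ.mono h)

theorem rel_symm {E : Entourage X} {a b : CoverSpace H} (h : (a, b) ∈ rel H E) :
    (b, a) ∈ rel H E := by
  obtain ⟨x, y, α, γ, hγ, e⟩ := h
  obtain ⟨rfl, rfl⟩ := Prod.mk.inj e
  have := mk_mem_rel (H := H) (α.trans γ) hγ.symm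
  rwa [GenPath.trans_cancel_right] at this

instance (H : Subgroup (UnifPi1 X x₀)) : UniformSpace (CoverSpace H) :=
  UniformSpace.ofCore <| UniformSpace.Core.mkOfBasis
    { sets := Set.range (rel H)
      nonempty := ⟨_, ⟨⟨Set.univ, Filter.univ_mem, fun _ => trivial⟩, rfl⟩⟩
      inter_sets := by
        rintro _ _ ⟨E, rfl⟩ ⟨F, rfl⟩
        exact ⟨_, ⟨E.inter F, rfl⟩, Set.subset_inter (rel_mono Set.inter_subset_left)
          (rel_mono Set.inter_subset_right)⟩ }
    (by
      rintro _ ⟨E, rfl⟩ a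
      obtain ⟨x, α, rfl⟩ := exists_mk a
      exact mem_rel_iff.2 ⟨x, .refl x, GenPath.isShort_refl E x, by rw [GenPath.trans_refl]⟩)
    (by
      rintro _ ⟨E, rfl⟩
      exact ⟨_, ⟨E, rfl⟩, fun _ h => rel_symm h⟩)
    (by
      rintro _ ⟨E, rfl⟩
      -- Two `F`-short paths are `E`-short because `F ⊆ E`, and their product is `E`-short because
      -- `F ∘ F ⊆ E` closes the triangle.
      obtain ⟨t, ht, htE⟩ := comp_mem_uniformity_sets E.mem
      obtain ⟨F, hF⟩ := Entourage.exists_subset (Filter.inter_mem ht E.mem)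
      refine ⟨_, ⟨F, rfl⟩, ?_⟩
      rintro ⟨a, c⟩ ⟨b, hab, hbc⟩
      obtain ⟨x, α, rfl⟩ := exists_mk a
      obtain ⟨y, γ, hγ, rfl⟩ := mem_rel_iff.1 hab
      obtain ⟨z, δ, hδ, rfl⟩ := mem_rel_iff.1 hbc
      have hFE : F.rel ⊆ E.rel := hF.trans Set.inter_subset_right
      have hxz : (x, z) ∈ E.rel := htE ⟨y, (hF hγ.1).1, (hF hδ.1).1⟩
      rw [GenPath.trans_assoc]
      exact mk_mem_rel α ((hγ.mono hFE).trans (hδ.mono hFE) hxz))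

theorem mem_uniformity_iff {s : Set (CoverSpace H × CoverSpace H)} :
    s ∈ 𝓤 (CoverSpace H) ↔ ∃ E, rel H E ⊆ s := by
  refine (FilterBasis.mem_filter_iff _).trans ⟨?_, ?_⟩
  · rintro ⟨_, ⟨E, rfl⟩, h⟩
    exact ⟨E, h⟩
  · rintro ⟨E, h⟩
    exact ⟨_, ⟨E, rfl⟩, h⟩

theorem uniformContinuous_proj (H : Subgroup (UnifPi1 X x₀)) : UniformContinuous (proj H) := by
  rw [uniformContinuous_def]
  intro s hs
  obtain ⟨E, hE⟩ := Entourage.exists_subset hs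
  refine mem_uniformity_iff.2 ⟨E, ?_⟩
  rintro _ ⟨x, y, α, γ, hγ, rfl⟩
  exact hE hγ.1

theorem _root_.UniformCovering.EChain.exists_points_eq_cons {A : Type u} {E : Set (A × A)} {x y : A}
    (c : EChain E x y) : ∃ l, c.points = x :: l := by
  cases c <;> exact ⟨_, rfl⟩

/-- Joinability provides the short paths needed to lift edges, and chain connectedness a path from
`x₀` to every point. Semilocal simplicity makes a short path between given points unique, whence
unique lifts. -/
theorem isUniformCoveringMap_proj (hjoin : LocallyUniformJoinable X) (hchain : ChainConnected X)
    (hsemi : SemilocallySimplyUniformJoinable X) (H : Subgroup (UnifPi1 X x₀)) :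
    IsUniformCoveringMap (proj H) where
  generates := by
    refine ⟨uniformContinuous_proj H, fun s hs => ?_⟩
    obtain ⟨E, hE⟩ := mem_uniformity_iff.1 hs
    obtain ⟨F, -, hF⟩ := hjoin E
    refine Filter.mem_of_superset F.mem ?_
    rintro ⟨x, y⟩ hxy
    obtain ⟨α⟩ := GenPath.nonempty hjoin hchain x₀ x
    obtain ⟨γ, hγ⟩ := hF x y hxy
    exact ⟨_, hE (mk_mem_rel α hγ), rfl⟩
  chainLifting := by
    intro s hs
    obtain ⟨E, hE⟩ := mem_uniformity_iff.1 hs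
    obtain ⟨F, -, hF⟩ := hjoin E
    refine ⟨rel H F, mem_uniformity_iff.2 ⟨F, subset_rfl⟩, ?_⟩
    have key : ∀ {x y : X} (c : EChain (Prod.map (proj H) (proj H) '' rel H F) x y)
        (a : CoverSpace H), proj H a = x →
        ∃ (b : CoverSpace H) (d : EChain s a b), d.points.map (proj H) = c.points := by
      intro x y c
      induction c with
      | nil x =>
        rintro a rfl
        exact ⟨a, .nil a, rfl⟩
      | cons h c ih =>
        intro a ha
        obtain ⟨x, α, rfl⟩ := exists_mk a
        obtain ⟨_, ⟨x', y', α', γ', hγ', rfl⟩, e⟩ := h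
        obtain ⟨rfl, rfl⟩ := Prod.mk.inj e
        obtain rfl : x = x' := ha
        -- The edge downstairs may come from another sheet, so only its endpoints are used; a new
        -- short path over it is attached to `α`.
        obtain ⟨γ, hγ⟩ := hF x y' hγ'.1
        obtain ⟨b, d, hd⟩ := ih (mk H (α.trans γ)) rfl
        exact ⟨b, .cons (hE (mk_mem_rel α hγ)) d, by simp [EChain.points, hd]⟩
    exact fun a y c => key c a rfl
  uniqueChainLifts := by
    intro s hs
    obtain ⟨E, hE⟩ := hsemi
    refine ⟨rel H E ∩ s, Filter.inter_mem (mem_uniformity_iff.2 ⟨E, subset_rfl⟩) hs,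
      Set.inter_subset_right, ?_⟩
    have huniq : ∀ {a b c : CoverSpace H}, (a, b) ∈ rel H E → (a, c) ∈ rel H E →
        proj H b = proj H c → b = c := by
      intro a b c hab hac hbc
      obtain ⟨x, α, rfl⟩ := exists_mk a
      obtain ⟨y, γ, hγ, rfl⟩ := mem_rel_iff.1 hab
      obtain ⟨z, δ, hδ, rfl⟩ := mem_rel_iff.1 hac
      obtain rfl : y = z := hbc
      rw [GenPath.eq_of_term_eq hE (hγ.2.trans hδ.2.symm)]
    intro a b b' c
    induction c with
    | nil a =>
      intro d h
      cases d with
      | nil => rfl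
      | cons h' d =>
        obtain ⟨l, hl⟩ := d.exists_points_eq_cons
        simp [EChain.points, hl] at h
    | cons h' c ih =>
      intro d h
      cases d with
      | nil =>
        obtain ⟨l, hl⟩ := c.exists_points_eq_cons
        simp [EChain.points, hl] at h
      | cons h'' d =>
        simp only [EChain.points, List.map_cons, List.cons.injEq, true_and] at h ⊢
        obtain ⟨l, hl⟩ := c.exists_points_eq_cons
        obtain ⟨l', hl'⟩ := d.exists_points_eq_cons
        have e := h
        rw [hl, hl', List.map_cons, List.map_cons, List.cons.injEq] at e
        obtain rfl := huniq h'.1 h''.1 e.1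
        exact ih d h

theorem chainConnected (hjoin : LocallyUniformJoinable X)
    (hsemi : SemilocallySimplyUniformJoinable X) (H : Subgroup (UnifPi1 X x₀)) :
    ChainConnected (CoverSpace H) := by
  intro s hs a b
  obtain ⟨E, hE⟩ := mem_uniformity_iff.1 hs
  -- Both directions are carried along because `s` need not be symmetric.
  have key : ∀ {y : X} (α : GenPath x₀ y), Nonempty (EChain s (mk H (.refl x₀)) (mk H α)) ∧
      Nonempty (EChain s (mk H α) (mk H (.refl x₀))) := by
    intro y α
    refine GenPath.short_induction hjoin hsemi E (P := fun _ α =>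
      Nonempty (EChain s (mk H (.refl x₀)) (mk H α)) ∧
      Nonempty (EChain s (mk H α) (mk H (.refl x₀)))) ⟨⟨.nil _⟩, ⟨.nil _⟩⟩ ?_ α
    rintro y z α γ hγ ⟨⟨c⟩, ⟨d⟩⟩
    exact ⟨⟨c.append (.cons (hE (mk_mem_rel α hγ)) (.nil _))⟩,
      ⟨.cons (hE (rel_symm (mk_mem_rel α hγ))) d⟩⟩
  obtain ⟨x, α, rfl⟩ := exists_mk a
  obtain ⟨y, β, rfl⟩ := exists_mk b
  obtain ⟨c⟩ := (key α).2
  obtain ⟨d⟩ := (key β).1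
  exact ⟨c.append d⟩

/-- By induction on short pieces: the lift of a short piece and the class obtained by appending it
are both one small step from the same point and have the same projection, so they coincide. -/
theorem lifts_mk (hjoin : LocallyUniformJoinable X) (hchain : ChainConnected X)
    (hsemi : SemilocallySimplyUniformJoinable X) (H : Subgroup (UnifPi1 X x₀))
    (β : GenPath x₀ x) (γ : GenPath x y) :
    Lifts (proj H) (uniformContinuous_proj H) γ (mk H β) (mk H (β.trans γ)) := by
  have hf := isUniformCoveringMap_proj hjoin hchain hsemi H
  obtain ⟨E, G, hp, -⟩ := hf.exists_liftingPair Filter.univ_mem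
  obtain ⟨E₁, hE₁⟩ := mem_uniformity_iff.1 E.mem
  refine GenPath.short_induction hjoin hsemi (G.inter E₁) (P := fun _ γ =>
    Lifts (proj H) (uniformContinuous_proj H) γ (mk H β) (mk H (β.trans γ))) ?_ ?_ γ
  · rw [GenPath.trans_refl]
    exact Lifts.refl _ _ rfl
  · intro y z α γ hγ hα
    obtain ⟨w, hw⟩ := hf.exists_lifts (hu := uniformContinuous_proj H) hα.proj_right γ
    have h1 := hw.mem_of_isShort hp (hγ.mono Set.inter_subset_left)
    have h2 := hE₁ (mk_mem_rel (H := H) (β.trans α) (hγ.mono Set.inter_subset_right))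
    have h3 : w = _ := hp.unique' h1 h2 hw.proj_right
    subst h3
    rw [← GenPath.trans_assoc]
    exact hα.trans hw

theorem lifts_refl_iff (hjoin : LocallyUniformJoinable X) (hchain : ChainConnected X)
    (hsemi : SemilocallySimplyUniformJoinable X) (H : Subgroup (UnifPi1 X x₀))
    (α : UnifPi1 X x₀) :
    Lifts (proj H) (uniformContinuous_proj H) (x := x₀) (y := x₀) α (mk H (.refl x₀))
      (mk H (.refl x₀)) ↔ α ∈ H := by
  have hf := isUniformCoveringMap_proj hjoin hchain hsemi H
  have h0 : ∀ α : GenPath x₀ x₀, Lifts (proj H) (uniformContinuous_proj H) α (mk H (.refl x₀))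
      (mk H α) := fun α => by
    have := lifts_mk hjoin hchain hsemi H (.refl x₀) α
    rwa [GenPath.refl_trans] at this
  have h1 := h0 α
  have h2 : Lifts (proj H) (uniformContinuous_proj H) (x := x₀) (y := x₀) α (mk H (.refl x₀))
      (mk H (.refl x₀)) ↔ mk H (.refl x₀) = mk H (x := x₀) α :=
    ⟨fun h => h.unique hf h1, fun h => by rw [← h] at h1; exact h1⟩
  refine h2.trans (mk_eq_iff.trans ?_)
  constructor
  · rintro ⟨h, hh, rfl⟩
    change h * 1 ∈ H
    rwa [mul_one]
  · exact fun h => ⟨α, h, GenPath.trans_refl _⟩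

end CoverSpace

end CoverSpace

/-! ### Classification -/

section Classification

variable {Z : Type u} [UniformSpace Z] {f : Z → X} {hu : UniformContinuous f}

/-- The image of the universal entourage is an entourage, hence contains the diagonal. -/
theorem IsUniformCoveringMap.surjective (hf : IsUniformCoveringMap f) : Function.Surjective f := by
  intro x
  obtain ⟨⟨z, z'⟩, -, h⟩ := refl_mem_uniformity (x := x) (hf.generates.2 _ Filter.univ_mem)
  exact ⟨z, congrArg Prod.fst h⟩

/-- Nearby points of the covering space are joined by lifts of short generalized paths. -/
theorem IsUniformCoveringMap.exists_short_lifts (hf : IsUniformCoveringMap f)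
    (hjoin : LocallyUniformJoinable X) (E : Entourage X) :
    ∃ D ∈ 𝓤 Z, ∀ z z', (z, z') ∈ D →
      ∃ γ : GenPath (f z) (f z'), γ.IsShort E ∧ Lifts f hu γ z z' := by
  obtain ⟨E₀, G₀, hp, -⟩ := hf.exists_liftingPair Filter.univ_mem
  -- Shortness for `G₀` keeps the lift of `γ` within one `E₀`-step of `z`, which forces it to end at
  -- `z'`.
  obtain ⟨F, -, hF⟩ := hjoin (E.inter G₀)
  refine ⟨E₀.rel ∩ (F.comap f hu).rel, Filter.inter_mem E₀.mem (F.comap f hu).mem, ?_⟩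
  rintro z z' ⟨hE, hzz'⟩
  obtain ⟨γ, hγ⟩ := hF _ _ hzz'
  obtain ⟨w, hw⟩ := hf.exists_lifts (hu := hu) rfl γ
  obtain rfl : w = z' := hp.unique' (hw.mem_of_isShort hp (hγ.mono Set.inter_subset_right)) hE
    hw.proj_right
  exact ⟨γ, hγ.mono Set.inter_subset_left, hw⟩

/-- Each step of a fine chain from `z` to `z'` is spanned by a lift of a short path, and these lifts
compose. -/
theorem IsUniformCoveringMap.exists_lifts_between (hf : IsUniformCoveringMap f)
    (hjoin : LocallyUniformJoinable X) (hZ : ChainConnected Z) {z z' : Z} {x y : X}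
    (hx : f z = x) (hy : f z' = y) : ∃ γ : GenPath x y, Lifts f hu γ z z' := by
  subst hx hy
  obtain ⟨D, hD, hD'⟩ := hf.exists_short_lifts (hu := hu) hjoin
    ⟨Set.univ, Filter.univ_mem, fun _ => trivial⟩
  obtain ⟨c⟩ := hZ D hD z z'
  induction c with
  | nil z => exact ⟨.refl _, .refl f hu rfl⟩
  | cons h c ih =>
    obtain ⟨γ, -, hγ⟩ := hD' _ _ h
    obtain ⟨δ, hδ⟩ := ih
    exact ⟨γ.trans δ, hγ.trans hδ⟩

/-- A chain connected covering space is determined by the subgroup of the generalized loops that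
lift to loops. -/
theorem IsUniformCoveringMap.exists_uniformEquiv (hf : IsUniformCoveringMap f)
    (hjoin : LocallyUniformJoinable X) (hZ : ChainConnected Z) {x₀ : X} {z₀ : Z}
    (hz₀ : f z₀ = x₀) {H : Subgroup (UnifPi1 X x₀)}
    (hH : ∀ α : GenPath x₀ x₀, Lifts f hu α z₀ z₀ ↔ @Membership.mem (UnifPi1 X x₀) _ _ H α) :
    ∃ e : CoverSpace H ≃ᵤ Z, CoverSpace.proj H = f ∘ e := by
  have hex : ∀ a : Σ x, GenPath x₀ x, ∃ w, Lifts f hu a.2 z₀ w := fun a =>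
    hf.exists_lifts hz₀ a.2
  choose φ₀ hφ₀ using hex
  -- A class goes to the endpoint of the lift from `z₀`. Prefixing an element of `H` changes
  -- nothing, since it lifts to a loop at `z₀`.
  let φ : CoverSpace H → Z := Quotient.lift φ₀ (by
    rintro a _ ⟨h, hh, rfl⟩
    exact (((hH h).2 hh).trans (hφ₀ a)).unique hf (hφ₀ ⟨a.1, GenPath.trans h a.2⟩))
  have hφ : ∀ {x : X} (α : GenPath x₀ x), Lifts f hu α z₀ (φ (CoverSpace.mk H α)) :=
    fun {x} α => hφ₀ ⟨x, α⟩
  have hinj : Function.Injective φ := by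
    intro a b hab
    obtain ⟨x, α, rfl⟩ := a.exists_mk
    obtain ⟨y, β, rfl⟩ := b.exists_mk
    have h1 := hφ α
    have h2 := hφ β
    rw [← hab] at h2
    obtain rfl := h1.proj_right.symm.trans h2.proj_right
    -- If two paths lift to the same endpoint, one followed by the inverse of the other lifts to a
    -- loop at `z₀`, so it lies in `H`.
    exact CoverSpace.mk_eq_iff.2 ⟨_, (hH _).1 (h2.trans h1.symm),
      GenPath.trans_symm_cancel_right β α⟩
  have hsurj : Function.Surjective φ := by
    intro z
    obtain ⟨γ, hγ⟩ := hf.exists_lifts_between (hu := hu) hjoin hZ hz₀ (rfl : f z = f z)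
    exact ⟨CoverSpace.mk H γ, (hφ γ).unique hf hγ⟩
  have htrans : ∀ {x y : X} (α : GenPath x₀ x) (γ : GenPath x y) {w : Z},
      Lifts f hu γ (φ (CoverSpace.mk H α)) w → φ (CoverSpace.mk H (α.trans γ)) = w :=
    fun α γ w hw => (hφ (α.trans γ)).unique hf ((hφ α).trans hw)
  let e : CoverSpace H ≃ Z := Equiv.ofBijective φ ⟨hinj, hsurj⟩
  refine ⟨⟨e, ?_, ?_⟩, ?_⟩
  · rw [uniformContinuous_def]
    intro s hs
    obtain ⟨E, G, hp, hE⟩ := hf.exists_liftingPair hs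
    refine CoverSpace.mem_uniformity_iff.2 ⟨G, ?_⟩
    rintro _ ⟨x, y, α, γ, hγ, rfl⟩
    obtain ⟨w, hw⟩ := hf.exists_lifts (hu := hu) (hφ α).proj_right γ
    have h1 := hE (hw.mem_of_isShort hp hγ)
    rw [← htrans α γ hw] at h1
    exact h1
  · rw [uniformContinuous_def]
    intro s hs
    obtain ⟨E, hE⟩ := CoverSpace.mem_uniformity_iff.1 hs
    obtain ⟨D, hD, hD'⟩ := hf.exists_short_lifts (hu := hu) hjoin E
    refine Filter.mem_of_superset hD ?_
    rintro ⟨z, z'⟩ hzz'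
    obtain ⟨a, rfl⟩ := hsurj z
    obtain ⟨x, α, rfl⟩ := a.exists_mk
    obtain ⟨γ, hγ, hl⟩ := hD' _ _ hzz'
    have hxx : f (φ (CoverSpace.mk H α)) = x := (hφ α).proj_right
    -- The starting point of `γ` is generalized so that it can be identified with the endpoint `x`
    -- of `α` by substitution.
    have key : ∀ {x' : X} (_ : x' = x) (γ : GenPath x' (f z')), γ.IsShort E →
        Lifts f hu γ (φ (CoverSpace.mk H α)) z' → (e.symm (φ (CoverSpace.mk H α)), e.symm z') ∈ s := by
      rintro _ rfl γ hγ hl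
      have h1 := hE (CoverSpace.mk_mem_rel (H := H) α hγ)
      have h2 : e.symm (φ (CoverSpace.mk H α)) = CoverSpace.mk H α :=
        (Equiv.symm_apply_eq e).2 rfl
      have h3 : e.symm z' = CoverSpace.mk H (α.trans γ) := by
        rw [Equiv.symm_apply_eq]
        exact (htrans α γ hl).symm
      rwa [h2, h3]
    exact key hxx γ hγ hl
  · funext a
    obtain ⟨x, α, rfl⟩ := a.exists_mk
    exact (hφ α).proj_right.symm

/-- Travelling along the lift of `g`, around the loop at `z'` and back is a loop at `z`: changing
the base point in its fibre conjugates the loop subgroup. -/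
theorem Lifts.conj_iff {x : X} {z z' : Z} {g : UnifPi1 X x}
    (hg : Lifts f hu (x := x) (y := x) g z z') (β : UnifPi1 X x) :
    Lifts f hu (x := x) (y := x) β z' z' ↔
      Lifts f hu (x := x) (y := x) (g * β * g⁻¹ : UnifPi1 X x) z z := by
  refine ⟨fun h => (hg.trans h).trans hg.symm, fun h => ?_⟩
  have h1 := (hg.symm.trans h).trans hg
  have h2 : g⁻¹ * (g * β * g⁻¹) * g = β := by group
  exact h2 ▸ h1

end Classification

theorem subgroupConj_iff {G : Type u} [Group G] {H K : Subgroup G} :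
    (subgroupConjSetoid G).r H K ↔ ∃ g : G, ∀ a, a ∈ H ↔ g * a * g⁻¹ ∈ K := by
  refine exists_congr fun g => ?_
  constructor
  · rintro rfl a
    simp [Subgroup.mem_map]
  · intro h
    ext a
    rw [Subgroup.mem_map]
    constructor
    · rintro ⟨b, hb, rfl⟩
      exact (h b).1 hb
    · intro ha
      refine ⟨g⁻¹ * a * g, (h _).2 ?_, ?_⟩
      · convert ha using 1
        group
      · simp [mul_assoc]

theorem CoverSpace.image_proj (hjoin : LocallyUniformJoinable X) (hchain : ChainConnected X)
    (hsemi : SemilocallySimplyUniformJoinable X) {x₀ : X} (H : Subgroup (UnifPi1 X x₀)) :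
    UnifPi1.image (proj H) (uniformContinuous_proj H) (x := mk H (.refl x₀)) (y := x₀)
      (proj_mk _) = H :=
  Subgroup.ext fun α => (UnifPi1.mem_image_iff (proj_mk _) α).trans
    (lifts_refl_iff hjoin hchain hsemi H α)

/-! ### Equivalence of coverings and conjugacy of their loop subgroups -/

namespace ChainConnectedCovering

variable {x₀ : X}

theorem exists_point (f : ChainConnectedCovering X) (x : X) : ∃ z, f.proj z = x :=
  f.isCovering.surjective x

/-- The subgroup of the generalized loops at `x₀` that lift to loops at `z₀`. -/
abbrev loops (f : ChainConnectedCovering X) {z₀ : f.space} (h : f.proj z₀ = x₀) :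
    Subgroup (UnifPi1 X x₀) :=
  UnifPi1.image f.proj f.isCovering.generates.1 h

/-- The equivalence and its inverse carry lifts to lifts, so loops at `z₀` match loops at `k z₀`; a
path lifting from `w₀` to `k z₀` supplies the conjugating element. The case `f = g` is independence
of the base point. -/
theorem loops_conj_of_equiv (hjoin : LocallyUniformJoinable X) {f g : ChainConnectedCovering X}
    (hfg : f ≈ g) {z₀ : f.space} (hz : f.proj z₀ = x₀) {w₀ : g.space} (hw : g.proj w₀ = x₀) :
    SubgroupConjClasses.mk (f.loops hz) = SubgroupConjClasses.mk (g.loops hw) := by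
  obtain ⟨k, hk⟩ := hfg
  have hk' : g.proj = f.proj ∘ k.symm := by
    rw [hk]
    funext z
    simp
  have hkz : g.proj (k z₀) = x₀ := by
    rw [hk] at hz
    exact hz
  obtain ⟨γ, hγ⟩ := g.isCovering.exists_lifts_between (hu := g.isCovering.generates.1) hjoin
    g.chainConnected hw hkz
  refine Quotient.sound (s := subgroupConjSetoid _) (subgroupConj_iff.2 ⟨γ, fun a => ?_⟩)
  rw [UnifPi1.mem_image_iff, UnifPi1.mem_image_iff, ← hγ.conj_iff]
  refine ⟨fun h => h.comp k.uniformContinuous _ hk, fun h => ?_⟩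
  have h' := h.comp (k := k.symm) k.symm.uniformContinuous f.isCovering.generates.1 hk'
  rwa [k.symm_apply_apply] at h'

/-- The covering associated with a subgroup. -/
def ofSubgroup (hjoin : LocallyUniformJoinable X) (hchain : ChainConnected X)
    (hsemi : SemilocallySimplyUniformJoinable X) (H : Subgroup (UnifPi1 X x₀)) :
    ChainConnectedCovering X where
  space := CoverSpace H
  proj := CoverSpace.proj H
  isCovering := CoverSpace.isUniformCoveringMap_proj hjoin hchain hsemi H
  chainConnected := CoverSpace.chainConnected hjoin hsemi H

theorem equiv_of_loops_conj (hjoin : LocallyUniformJoinable X) (hchain : ChainConnected X)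
    (hsemi : SemilocallySimplyUniformJoinable X) {f g : ChainConnectedCovering X}
    {z₀ : f.space} (hz : f.proj z₀ = x₀) {w₀ : g.space} (hw : g.proj w₀ = x₀)
    (h : SubgroupConjClasses.mk (f.loops hz) = SubgroupConjClasses.mk (g.loops hw)) : f ≈ g := by
  obtain ⟨k, hk⟩ := subgroupConj_iff.1 (Quotient.exact h)
  -- Moving the base point of `g` along the lift of the conjugator `k` turns conjugate subgroups
  -- into equal ones, so both coverings are modelled by the same `CoverSpace`.
  obtain ⟨w₁, hw₁⟩ := g.isCovering.exists_lifts (hu := g.isCovering.generates.1) hw k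
  have e₁ : ofSubgroup hjoin hchain hsemi (f.loops hz) ≈ f :=
    f.isCovering.exists_uniformEquiv (hu := f.isCovering.generates.1) hjoin f.chainConnected hz
      fun α => (UnifPi1.mem_image_iff hz α).symm
  have e₂ : ofSubgroup hjoin hchain hsemi (f.loops hz) ≈ g :=
    g.isCovering.exists_uniformEquiv (hu := g.isCovering.generates.1) hjoin g.chainConnected
      hw₁.proj_right fun α =>
        (hw₁.conj_iff α).trans
          ((UnifPi1.mem_image_iff hw _).symm.trans (hk α).symm)
  exact Setoid.trans (Setoid.symm e₁) e₂

end ChainConnectedCovering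

end UniformCovering

theorem mainTheorem2 (X : Type u) [UniformSpace X] [T2Space X]
    (hjoin : LocallyUniformJoinable X) (hchain : ChainConnected X)
    (hsemi : SemilocallySimplyUniformJoinable X) (x₀ : X) :
    ∃ Φ : CoveringClasses X ≃ SubgroupConjClasses (UnifPi1 X x₀),
      ∀ (f : ChainConnectedCovering X) (z₀ : f.space) (h : f.proj z₀ = x₀),
        Φ (CoveringClasses.mk f) =
          SubgroupConjClasses.mk (UnifPi1.image f.proj f.isCovering.generates.1 h) := by
  let Φ : CoveringClasses X → SubgroupConjClasses (UnifPi1 X x₀) :=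
    Quotient.lift (fun f => SubgroupConjClasses.mk (f.loops (f.exists_point x₀).choose_spec))
      fun f g hfg => ChainConnectedCovering.loops_conj_of_equiv hjoin hfg _ _
  have hΦ : ∀ (f : ChainConnectedCovering X) (z₀ : f.space) (h : f.proj z₀ = x₀),
      Φ (CoveringClasses.mk f) = SubgroupConjClasses.mk (f.loops h) := fun f z₀ h =>
    -- The identity equivalence replaces the chosen point over `x₀` by the given `z₀`.
    ChainConnectedCovering.loops_conj_of_equiv hjoin (Setoid.refl f) _ h
  have hbij : Function.Bijective Φ := by
    constructor
    · intro a b hab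
      obtain ⟨f, rfl⟩ := Quotient.exists_rep a
      obtain ⟨g, rfl⟩ := Quotient.exists_rep b
      exact Quotient.sound (ChainConnectedCovering.equiv_of_loops_conj hjoin hchain hsemi _ _ hab)
    · intro c
      obtain ⟨H, rfl⟩ := Quotient.exists_rep c
      refine ⟨CoveringClasses.mk (.ofSubgroup hjoin hchain hsemi H), ?_⟩
      have h := congrArg SubgroupConjClasses.mk (CoverSpace.image_proj hjoin hchain hsemi H)
      have h' := hΦ (.ofSubgroup hjoin hchain hsemi H) (CoverSpace.mk H (GenPath.refl x₀))
        (CoverSpace.proj_mk (H := H) (GenPath.refl x₀))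
      exact h'.trans h
  exact ⟨Equiv.ofBijective Φ hbij, hΦ⟩
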